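/- Let $n\ge 4$, let $X=(x_{ij})_{i,j=1}^n$ be a matrix of independent variables, and let $\mathbb C(X)=\mathbb C(GL_n)$ be the field of rational functions in its entries. **Generalized cluster structures.** Let $Q$ be a quiver with mutable and frozen vertices and with a multiplicity $d_k\ge1$ at every mutable vertex $k$; let $b_{ij}$ be the number of arrows $i\to j$. A seed consists of $Q$, of elements $x_i$ of a field attached to all vertices, and, for each mutable $k$, of a string $(p_{k0},\dots,p_{kd_k})$ of Laurent monomials in the frozen variables with $p_{k0}=p_{kd_k}=1$. The adjacent seed in direction $k$ is obtained by replacing $x_k$ with $x_k'$ given by $$x_kx_k'=\sum_{r=0}^{d_k}p_{kr}\prod_{i\ \text{mutable}}x_i^{rb_{ki}+(d_k-r)b_{ik}}\prod_{i\ \text{frozen}}x_i^{\lfloor rb_{ki}/d_k\rfloor+\lfloor (d_k-r)b_{ik}/d_k\rfloor},$$ by replacing $p_{kr}$ with $p_{k,d_k-r}$, and by changing the quiver as follows: each path $i\to k\to j$ contributes $d_k$ arrows $i\to j$ if $i,j$ are mutable, $d_j$ arrows if only $j$ is mutable, $d_i$ arrows if only $i$ is mutable, and none if both are frozen; then all arrows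 at $k$ are reversed and 2-cycles are cancelled. The generalized cluster structure of a seed is the set of all seeds that can be reached from it through successive adjacent seeds. Its cluster variables are the elements attached to the vertices (mutable or frozen) in these seeds. **Functions.** For row sets $I_1,\dots,I_k\subseteq[1,n]$ let ${\tt G}(I_1,\dots,I_k)$ be the matrix with $n+k-1$ columns in which the blocks $X_{I_1},\dots,X_{I_k}$ (the rows of $X$ listed in $I_s$) are stacked one below the other, $X_{I_s}$ being preceded by $s-1$ and followed by $k-s$ zero columns. Put ${\tt g}_{ij}(X)=\det{\tt G}(\{1,n\}^{j-2},\{1\}\cup[n+j-i,n],\{1\}\cup[i+1,n])$ for $2\le j\le i\le n-1$, where $\{1,n\}^{j-2}$ means $j-2$ blocks $\{1,n\}$. Let ${\tt F}(X)$ be the $(2n-1)\times(2n-1)$ matrix ${\tt G}(\{n\},\{1,n\}^{n-1})$ and let ${\tt f}_m(X)$ be its trailing principal $m\times m$ minor. Let ${\tt A},{\tt B}$ be the $(n+1)\times(n+1)$ matrices with ${\tt A}_{[1,n]}^{[3,n+1]}=X^{[1,n-1]}$, ${\tt B}_{[1,n]}^{[1,1]}=X^{[n,n]}$, ${\tt B}_{[2,n+1]}^{[2,n+1]}=X$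 (subscripts are rows, superscripts are columns) and all other entries zero, and let $(-1)^{rn}{\tt c}_r(X)$ be the coefficient at $\lambda^r$ of $\det(\lambda{\tt A}+{\tt B})$. For $k,l\ge1$, $k+l\le n-1$, put $\phi_{kl}(X)=\det\Phi_{kl}(X)$, where $\Phi_{kl}(X)$ is the square matrix of size $(n-k-l)(n+1)$ built from $m=n-k-l$ block columns of width $n+1$: the $i$-th block column consists, from top to bottom, of $(i-1)n$ zero rows, of $[X_{P}\ 0]$, of $[0\ X_{R}]$, and of zero rows, where $P=[2,n]$ for $i<m$ and $P=[l+1,n]$ for $i=m$, while $R=\{1\}\cup[3,n]$ for $i<m-1$, $R=\{1\}\cup[l+2,n]$ for $i=m-1$, and $R=\{1\}\cup[k+2,n]$ for $i=m$. **Initial seed.** The mutable vertices of $Q_n$, with the attached variables, are: $(k,l)$, $k,l\ge1$, $k+l\le n-1$, with $\phi_{kl}(X)$; $\langle i,j\rangle$, $2\le j\le i\le n-1$, with ${\tt g}_{ij}(X)$; $(m,+)$, $1\le m\le n-2$, with ${\tt f}_{2m}(X)$; $(m,-)$, $1\le m\le n-1$, with ${\tt f}_{2m-1}(X)$. The frozen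 ones are $A$, $B$, $C$ with $x_{1n}$, $\det X$, $x_{n1}$, and isolated vertices with ${\tt c}_r(X)$, $1\le r\le n-2$. Write $(n-1,+)$ for the vertex $D=\langle n-1,n-1\rangle$ and $(n,-)$ for $C$. The arrows of $Q_n$ (those in the following list whose ends exist, repeated ones counted with multiplicity) are: * $(k,l)\to(k-1,l+1)$; $(k,l)\to(k+1,l)$ for $l\ne1$; $(k,l)\to(k,l-1)$; $(1,l)\to(l+1,1)\to(1,l+1)$ for $1\le l\le n-3$; * $\langle i,j\rangle\to\langle i-1,j\rangle$; $\langle i,j\rangle\to\langle i+1,j+1\rangle$ for $i\ne j$; $\langle i,j\rangle\to\langle i,j-1\rangle$; $\langle n-1,j-1\rangle\to\langle j-1,j-1\rangle\to\langle n-1,j\rangle$ for $3\le j\le n-1$; * $\langle m,2\rangle\to(m-1,n-m)$ for $2\le m\le n-1$; $(m-1,n-m)\to\langle m+1,2\rangle$ for $2\le m\le n-2$; * $(m,+)\to(m-1,+)$ for $2\le m\le n-1$; $(m,-)\to(m-1,-)$ for $2\le m\le n$; double arrows $(m,-)\Rightarrow(m,+)\Rightarrow(m+1,-)$ for $1\le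 m\le n-2$; $(n-1,-)\to D$; * $D\to C$; $(1,1)\to C\to\langle2,2\rangle$; $(n-2,1)\to A\to(1,1)$; $A\to(1,-)$; $(n-2,1)\to B\to\langle n-1,2\rangle$. The multiplicity of $(1,1)$ is $n-1$ and its string is $(1,{\tt c}_1(X)/\det X,\dots,{\tt c}_{n-2}(X)/\det X,1)$; all other multiplicities and all other exchange coefficients are $1$. Let $\mathcal{GC}_n$ be the generalized cluster structure of this seed in $\mathbb C(X)$. **Proposition.** Every cluster variable $f$ of $\mathcal{GC}_n$ is a homogeneous function in the entries of $X$: there is $d\in\mathbb Z$ with $f(aX)=a^df(X)$ for all $a\in\mathbb C^*$. It is also homogeneous with respect to the action $X\mapsto t^{D_n}Xs^{\bar D_n}$, where $D_n=\operatorname{diag}(n,\dots,2,1)$, $\bar D_n=\operatorname{diag}(1,2,\dots,n)$ and $t^{\operatorname{diag}(d_1,\dots,d_n)}=\operatorname{diag}(t^{d_1},\dots,t^{d_n})$: there are $\xi,\bar\xi\in\mathbb Z$ with $$f(t^{D_n}Xs^{\bar D_n})=t^{\xi}s^{\bar\xi}f(X)\qquad\text{for all } t,s\in\mathbb C^*.$$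 In both identities $X$ is any complex $n\times n$ matrix in the domain of the rational function $f$, and the left-hand side is then defined as well. -/

import Mathlib

noncomputable section

namespace GCn

/-! ### Generalized cluster structures given by quivers with multiplicities -/

/-- An extended seed with mutable vertices `M` and frozen vertices `F` in the field `K`.
`var` is the extended cluster, `mult k` the multiplicity `d_k` of a mutable vertex, `arrows i j` the
number of arrows `i → j`.  The `r`-th exchange coefficient `p_{kr}`, `0 ≤ r ≤ d_k`, of the `k`-th
string is the Laurent monomial in the frozen variables with exponent vector `coeff k r`;
the first and the last ones are equal to one. -/
structure ExtendedSeed (M F K : Type*) where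
  var : M ⊕ F → K
  mult : M → ℕ
  arrows : M ⊕ F → M ⊕ F → ℕ
  coeff : M → ℕ → F → ℤ
  coeff_zero : ∀ k, coeff k 0 = 0
  coeff_mult : ∀ k, coeff k (mult k) = 0

namespace ExtendedSeed

variable {M F K : Type*} [Fintype M] [Fintype F] [Field K]

/-- `u_{k;>}`: the product of the mutable variables at the heads of the arrows from `k`. -/
def uOut (S : ExtendedSeed M F K) (k : M) : K :=
  ∏ i : M, S.var (Sum.inl i) ^ S.arrows (Sum.inl k) (Sum.inl i)

/-- `u_{k;<}`: the product of the mutable variables at the tails of the arrows to `k`. -/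
def uIn (S : ExtendedSeed M F K) (k : M) : K :=
  ∏ i : M, S.var (Sum.inl i) ^ S.arrows (Sum.inl i) (Sum.inl k)

/-- `v_{k;>}^{[s]}`; the division in the exponent is the floor. -/
def vOut (S : ExtendedSeed M F K) (k : M) (s : ℕ) : K :=
  ∏ i : F, S.var (Sum.inr i) ^ (s * S.arrows (Sum.inl k) (Sum.inr i) / S.mult k)

/-- `v_{k;<}^{[s]}`; the division in the exponent is the floor. -/
def vIn (S : ExtendedSeed M F K) (k : M) (s : ℕ) : K :=
  ∏ i : F, S.var (Sum.inr i) ^ (s * S.arrows (Sum.inr i) (Sum.inl k) / S.mult k)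

/-- The exchange coefficient `p_{kr}`. -/
def exchangeCoeff (S : ExtendedSeed M F K) (k : M) (r : ℕ) : K :=
  ∏ i : F, S.var (Sum.inr i) ^ S.coeff k r i

/-- The right-hand side of the generalized exchange relation at `k`. -/
def exchangeRHS (S : ExtendedSeed M F K) (k : M) : K :=
  ∑ r ∈ Finset.range (S.mult k + 1),
    S.exchangeCoeff k r * S.uOut k ^ r * S.vOut k r *
      S.uIn k ^ (S.mult k - r) * S.vIn k (S.mult k - r)

/-- The number of arrows `i → j` contributed by a single path `i → k → j` when mutating at `k`. -/
def pathWeight (S : ExtendedSeed M F K) (k : M) : M ⊕ F → M ⊕ F → ℕ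
  | Sum.inl _, Sum.inl _ => S.mult k
  | Sum.inl i, Sum.inr _ => S.mult i
  | Sum.inr _, Sum.inl j => S.mult j
  | Sum.inr _, Sum.inr _ => 0

/-- The number of arrows `i → j` after the arrows given by the paths `i → k → j` are added. -/
def arrowsWithPaths (S : ExtendedSeed M F K) (k : M) (i j : M ⊕ F) : ℕ :=
  S.arrows i j + S.pathWeight k i j * (S.arrows i (Sum.inl k) * S.arrows (Sum.inl k) j)

variable [DecidableEq M] [DecidableEq F]

/-- The adjacent seed in direction `k`.  In the quiver, all arrows at `k` are reversed, the paths
through `k` contribute new arrows, and 2-cycles are cancelled (the truncated subtraction). -/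
def mutate (S : ExtendedSeed M F K) (k : M) : ExtendedSeed M F K where
  var := Function.update S.var (Sum.inl k) (S.exchangeRHS k / S.var (Sum.inl k))
  mult := S.mult
  arrows := fun i j =>
    if i = Sum.inl k ∨ j = Sum.inl k then S.arrows j i
    else S.arrowsWithPaths k i j - S.arrowsWithPaths k j i
  coeff := fun i r => if i = k then S.coeff k (S.mult k - r) else S.coeff i r
  coeff_zero := by
    intro i
    by_cases h : i = k
    · simp [h, S.coeff_mult]
    · simp [h, S.coeff_zero]
  coeff_mult := by
    intro i
    by_cases h : i = k
    · simp [h, S.coeff_zero]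
    · simp [h, S.coeff_mult]

/-- `S'` is adjacent to `S`. -/
def Adjacent (S S' : ExtendedSeed M F K) : Prop := ∃ k : M, S' = S.mutate k

/-- The generalized cluster structure `GC(S)`: the set of all seeds that can be connected with `S`
by a sequence of pairwise adjacent seeds. -/
def clusterStructure (S : ExtendedSeed M F K) : Set (ExtendedSeed M F K) :=
  {S' | Relation.ReflTransGen Adjacent S S'}

/-- All cluster variables (frozen ones included) of the generalized cluster structure `GC(S)`. -/
def clusterVariables (S : ExtendedSeed M F K) : Set K :=
  {f | ∃ S' ∈ S.clusterStructure, ∃ v : M ⊕ F, f = S'.var v}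

end ExtendedSeed

/-! ### The functions of the initial cluster -/

section Functions

variable {R : Type*} [CommRing R] {n : ℕ}

/-- The entry `x_{ij}` of `X` in 1-based numbering, extended by zero to all other indices. -/
def entry (X : Matrix (Fin n) (Fin n) R) (i j : ℕ) : R :=
  if h : (1 ≤ i ∧ i ≤ n) ∧ (1 ≤ j ∧ j ≤ n) then
    X ⟨i - 1, by omega⟩ ⟨j - 1, by omega⟩
  else 0

/-- The nonzero rows, from top to bottom, of the `b`-th block column (`b = 0, …, n-k-l-1`) of the
matrix `Φ_{kl}`: the pair `(i, s)` stands for the `i`-th row of `X` placed with `s` leading zeros.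
The rows of the second tier are `[2,n]`, or `[l+1,n]` in the last block column. The rows of the
third tier are `1` and `[3,n]`, or `1` and `[l+2,n]` in the last but one block column,
or `1` and `[k+2,n]` in the last one. -/
def phiRows (n k l b : ℕ) : List (ℕ × ℕ) :=
  let m := n - k - l
  let p := if b + 1 = m then l else 1
  let q := if b + 1 = m then k else if b + 2 = m then l else 1
  (List.range' (p + 1) (n - p)).map (fun i => (i, 0)) ++
    (1 :: List.range' (q + 2) (n - q - 1)).map (fun i => (i, 1))

/-- The matrix `Φ_{kl}(X)` of size `(n-k-l)(n+1)`.  It consists of `n-k-l` block columns of width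
`n+1`; the nonzero rows of the `b`-th block column start after `b * n` zero rows. -/
def phiMatrix (X : Matrix (Fin n) (Fin n) R) (k l : ℕ) :
    Matrix (Fin ((n - k - l) * (n + 1))) (Fin ((n - k - l) * (n + 1))) R :=
  Matrix.of fun r c =>
    let b := (c : ℕ) / (n + 1)
    if b * n ≤ (r : ℕ) then
      let q := (phiRows n k l b).getD ((r : ℕ) - b * n) (0, 0)
      entry X q.1 ((c : ℕ) % (n + 1) + 1 - q.2)
    else 0

/-- `φ_{kl}(X)`. -/
def phiFun (X : Matrix (Fin n) (Fin n) R) (k l : ℕ) : R := (phiMatrix X k l).det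

/-- The rows of `G(I_1, …, I_k)` listed from top to bottom: the pair `(i, s)` stands for the `i`-th
row of `X` placed with `s` leading zeros; the rows of the `s`-th block, `s = 0, …, k-1`, are shifted
by `s`. -/
def staircaseRows (L : List (List ℕ)) : List (ℕ × ℕ) :=
  L.zipIdx.flatMap (fun Is => Is.1.map (fun i => (i, Is.2)))

/-- The matrix `G_{ij}(X) = G({1,n}^{j-2}, 1 ∪ [n+j-i,n], 1 ∪ [i+1,n])` of size `n+j-1`. -/
def gMatrix (X : Matrix (Fin n) (Fin n) R) (i j : ℕ) :
    Matrix (Fin (n + j - 1)) (Fin (n + j - 1)) R :=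
  let rows := staircaseRows (List.replicate (j - 2) [1, n] ++
    [1 :: List.range' (n + j - i) (i + 1 - j), 1 :: List.range' (i + 1) (n - i)])
  Matrix.of fun r c =>
    let q := rows.getD (r : ℕ) (0, 0)
    entry X q.1 ((c : ℕ) + 1 - q.2)

/-- `g_{ij}(X)`. -/
def gFun (X : Matrix (Fin n) (Fin n) R) (i j : ℕ) : R := (gMatrix X i j).det

/-- The matrix `F(X)` of size `2n-1`: its rows are the last row of `X` without shift, the first and
the last rows of `X` shifted right by one, the first and the last rows shifted right by two, etc. -/
def fMatrix (X : Matrix (Fin n) (Fin n) R) : Matrix (Fin (2 * n - 1)) (Fin (2 * n - 1)) R :=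
  Matrix.of fun r c =>
    entry X (if Even (r : ℕ) then n else 1) ((c : ℕ) + 1 - ((r : ℕ) + 1) / 2)

/-- `f_m(X)`: the trailing principal `m × m` minor of `F(X)`, `m ≤ 2n-1`. -/
def fFun (X : Matrix (Fin n) (Fin n) R) (m : ℕ) : R :=
  ((fMatrix X).submatrix
    (Subtype.val : {r : Fin (2 * n - 1) // 2 * n - 1 - m ≤ (r : ℕ)} → Fin (2 * n - 1))
    (Subtype.val : {r : Fin (2 * n - 1) // 2 * n - 1 - m ≤ (r : ℕ)} → Fin (2 * n - 1))).det

/-- The `(n+1) × (n+1)` matrix `A(X)`: its submatrix in rows `[1,n]` and columns `[3,n+1]` consists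
of the first `n-1` columns of `X`, all other entries vanish. -/
def aMatrix (X : Matrix (Fin n) (Fin n) R) : Matrix (Fin (n + 1)) (Fin (n + 1)) R :=
  Matrix.of fun r c => entry X ((r : ℕ) + 1) ((c : ℕ) - 1)

/-- The `(n+1) × (n+1)` matrix `B(X)`: its submatrix in rows `[1,n]` and column `1` is the last
column of `X`, its submatrix in rows and columns `[2,n+1]` is `X`, all other entries vanish. -/
def bMatrix (X : Matrix (Fin n) (Fin n) R) : Matrix (Fin (n + 1)) (Fin (n + 1)) R :=
  Matrix.of fun r c => if (c : ℕ) = 0 then entry X ((r : ℕ) + 1) n else entry X (r : ℕ) (c : ℕ)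

/-- `c_r(X)`: the coefficient at `λ^r` of `det (λ A(X) + B(X))` with the sign `(-1)^{rn}`. -/
def cFun (X : Matrix (Fin n) (Fin n) R) (r : ℕ) : R :=
  (-1) ^ (r * n) *
    ((Polynomial.X : Polynomial R) • (aMatrix X).map Polynomial.C +
      (bMatrix X).map Polynomial.C).det.coeff r

end Functions

/-! ### The initial seed of `GC_n` -/

/-- Labels of the vertices of `Q_n`: `phi k l` is the vertex `(k,l)` of the left triangle, `g i j` is
the vertex `⟨i,j⟩` of the right triangle, `plus m` and `minus m` are `(m,+)` and `(m,-)`.  The vertex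
`D = ⟨n-1,n-1⟩ = (n-1,+)` is `g (n-1) (n-1)`, and the vertex `(n,-)` is `C`. -/
inductive Vertex where
  | phi (k l : ℕ)
  | g (i j : ℕ)
  | plus (m : ℕ)
  | minus (m : ℕ)
  | A
  | B
  | C
  | c (r : ℕ)
  deriving DecidableEq

/-- The mutable vertices of `Q_n`. -/
def mutableVertices (n : ℕ) : Finset Vertex :=
  ((Finset.Icc 1 (n - 2) ×ˢ Finset.Icc 1 (n - 2)).filter (fun q => q.1 + q.2 ≤ n - 1)).image
      (fun q => Vertex.phi q.1 q.2) ∪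
    ((Finset.Icc 2 (n - 1) ×ˢ Finset.Icc 2 (n - 1)).filter (fun q => q.2 ≤ q.1)).image
      (fun q => Vertex.g q.1 q.2) ∪
    (Finset.Icc 1 (n - 2)).image Vertex.plus ∪
    (Finset.Icc 1 (n - 1)).image Vertex.minus

/-- The frozen vertices of `Q_n`; the vertices `c r` are isolated. -/
def frozenVertices (n : ℕ) : Finset Vertex :=
  {Vertex.A, Vertex.B, Vertex.C} ∪ (Finset.Icc 1 (n - 2)).image Vertex.c

abbrev MutableVertex (n : ℕ) : Type := {v : Vertex // v ∈ mutableVertices n}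

abbrev FrozenVertex (n : ℕ) : Type := {v : Vertex // v ∈ frozenVertices n}

/-- The number of arrows from one vertex of `Q_n` to another. -/
def quiverArrows (n : ℕ) : Vertex → Vertex → ℕ
  -- the left triangle: arrows directed south, northeast (except for the upper side), northwest,
  -- and the path `(1,l) → (l+1,1) → (1,l+1)`, `1 ≤ l ≤ n-3`
  | .phi k l, .phi k' l' =>
      (if k = k' + 1 ∧ l' = l + 1 then 1 else 0) +
      (if k' = k + 1 ∧ l' = l ∧ l ≠ 1 then 1 else 0) +
      (if k' = k ∧ l = l' + 1 then 1 else 0) +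
      (if k = 1 ∧ k' = l + 1 ∧ l' = 1 then 1 else 0) +
      (if 2 ≤ k ∧ l = 1 ∧ k' = 1 ∧ l' = k then 1 else 0)
  -- the right triangle: arrows directed south, northeast (except for the lower side), northwest,
  -- and the path `⟨n-1,j-1⟩ → ⟨j-1,j-1⟩ → ⟨n-1,j⟩`, `3 ≤ j ≤ n-1`
  | .g i j, .g i' j' =>
      (if i = i' + 1 ∧ j' = j then 1 else 0) +
      (if i' = i + 1 ∧ j' = j + 1 ∧ i ≠ j then 1 else 0) +
      (if i' = i ∧ j = j' + 1 then 1 else 0) +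
      (if i = n - 1 ∧ j ≤ n - 2 ∧ i' = j ∧ j' = j then 1 else 0) +
      (if i = j ∧ i' = n - 1 ∧ j' = j + 1 then 1 else 0)
  -- arrows between the bases of the triangles: `⟨m,2⟩ → (m-1,n-m) → ⟨m+1,2⟩`
  | .g i j, .phi k l => if j = 2 ∧ k + 1 = i ∧ k + l = n - 1 then 1 else 0
  | .phi k l, .g i j => if j = 2 ∧ i = k + 2 ∧ k + l = n - 1 then 1 else 0
  -- the Toda part
  | .plus m, .plus m' => if m = m' + 1 then 1 else 0
  | .minus m, .minus m' => if m = m' + 1 then 1 else 0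
  | .minus m, .plus m' => if m' = m then 2 else 0
  | .plus m, .minus m' => if m' = m + 1 then 2 else 0
  -- the remaining arrows at `D`
  | .g i j, .plus m => if i = n - 1 ∧ j = n - 1 ∧ m = n - 2 then 1 else 0
  | .minus m, .g i j => if i = n - 1 ∧ j = n - 1 ∧ m = n - 1 then 1 else 0
  | .g i j, .C => if i = n - 1 ∧ j = n - 1 then 1 else 0
  -- the remaining arrows at the frozen vertices
  | .phi k l, .C => if k = 1 ∧ l = 1 then 1 else 0
  | .C, .g i j => if i = 2 ∧ j = 2 then 1 else 0
  | .C, .minus m => if m = n - 1 then 1 else 0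
  | .phi k l, .A => if k = n - 2 ∧ l = 1 then 1 else 0
  | .A, .phi k l => if k = 1 ∧ l = 1 then 1 else 0
  | .A, .minus m => if m = 1 then 1 else 0
  | .phi k l, .B => if k = n - 2 ∧ l = 1 then 1 else 0
  | .B, .g i j => if i = n - 1 ∧ j = 2 then 1 else 0
  | _, _ => 0

/-- The field of rational functions in the entries of an `n × n` matrix, i.e. the function field of
`GL_n` over `ℂ`. -/
abbrev RatFun (n : ℕ) : Type := FractionRing (MvPolynomial (Fin n × Fin n) ℂ)

/-- The matrix `X` of coordinate functions. -/
def genericMatrix (n : ℕ) : Matrix (Fin n) (Fin n) (RatFun n) :=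
  (Matrix.mvPolynomialX (Fin n) (Fin n) ℂ).map (algebraMap _ (RatFun n))

/-- The initial extended cluster `F_n`. -/
def initialVar (n : ℕ) : Vertex → RatFun n
  | .phi k l => phiFun (genericMatrix n) k l
  | .g i j => gFun (genericMatrix n) i j
  | .plus m => fFun (genericMatrix n) (2 * m)
  | .minus m => fFun (genericMatrix n) (2 * m - 1)
  | .A => entry (genericMatrix n) 1 n
  | .B => (genericMatrix n).det
  | .C => entry (genericMatrix n) n 1
  | .c r => cFun (genericMatrix n) r

/-- The only special vertex is `(1,1)`, its multiplicity is `n-1`. -/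
def initialMult (n : ℕ) (v : Vertex) : ℕ := if v = .phi 1 1 then n - 1 else 1

/-- The only nontrivial string is `(1, c_1(X)/det X, …, c_{n-2}(X)/det X, 1)` at `(1,1)`. -/
def initialCoeff (n : ℕ) (v : Vertex) (r : ℕ) (w : Vertex) : ℤ :=
  if v = .phi 1 1 ∧ 1 ≤ r ∧ r ≤ n - 2 then
    if w = .c r then 1 else if w = .B then -1 else 0
  else 0

/-- The vertex of `Q_n` underlying a mutable or a frozen vertex. -/
def toVertex {n : ℕ} : MutableVertex n ⊕ FrozenVertex n → Vertex :=
  Sum.elim Subtype.val Subtype.val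

/-- The initial seed `(F_n, Q_n, P_n)` of `GC_n`. -/
def initialSeed (n : ℕ) : ExtendedSeed (MutableVertex n) (FrozenVertex n) (RatFun n) where
  var := fun v => initialVar n (toVertex v)
  mult := fun k => initialMult n k.1
  arrows := fun v w => quiverArrows n (toVertex v) (toVertex w)
  coeff := fun k r w => initialCoeff n k.1 r w.1
  coeff_zero := by
    intro k
    funext w
    simp [initialCoeff]
  coeff_mult := by
    intro k
    funext w
    have h : ¬ (k.1 = Vertex.phi 1 1 ∧ 1 ≤ initialMult n k.1 ∧ initialMult n k.1 ≤ n - 2) := by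
      rintro ⟨h1, h2, h3⟩
      simp only [initialMult, h1, if_true] at h2 h3
      omega
    simp [initialCoeff, h]

/-! ### Homogeneity -/

/-- The rational function `f` is regular at the matrix `X` and takes the value `y` there. -/
def HasValueAt {n : ℕ} (f : RatFun n) (X : Matrix (Fin n) (Fin n) ℂ) (y : ℂ) : Prop :=
  ∃ p q : MvPolynomial (Fin n × Fin n) ℂ,
    MvPolynomial.eval (fun ij => X ij.1 ij.2) q ≠ 0 ∧
    f = algebraMap _ (RatFun n) p / algebraMap _ (RatFun n) q ∧
    y = MvPolynomial.eval (fun ij => X ij.1 ij.2) p / MvPolynomial.eval (fun ij => X ij.1 ij.2) q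

/-- `f` is a homogeneous function in the matrix entries: `f(aX) = a^d f(X)` for some integer `d`,
all `a ≠ 0`, and all `X` in the domain of `f` (which is invariant under rescaling). -/
def IsHomogeneous {n : ℕ} (f : RatFun n) : Prop :=
  ∃ d : ℤ, ∀ a : ℂ, a ≠ 0 → ∀ (X : Matrix (Fin n) (Fin n) ℂ) (y : ℂ),
    HasValueAt f X y → HasValueAt f (a • X) (a ^ d * y)

/-- `t^D` for `D = diag(d_1, …, d_n)`. -/
def powDiag {n : ℕ} (t : ℂ) (d : Fin n → ℕ) : Matrix (Fin n) (Fin n) ℂ :=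
  Matrix.diagonal (fun i => t ^ d i)

/-- `f` is homogeneous with respect to the action `X ↦ t^{D_n} X s^{D̄_n}` with
`D_n = diag(n, …, 2, 1)` and `D̄_n = diag(1, 2, …, n)`:
`f(t^{D_n} X s^{D̄_n}) = t^ξ s^{ξ'} f(X)` for some integers `ξ`, `ξ'` that depend only on `f`, all
`t, s ≠ 0`, and all `X` in the domain of `f` (which is invariant under the action). -/
def IsTorusHomogeneous {n : ℕ} (f : RatFun n) : Prop :=
  ∃ ξ ξ' : ℤ, ∀ t s : ℂ, t ≠ 0 → s ≠ 0 → ∀ (X : Matrix (Fin n) (Fin n) ℂ) (y : ℂ),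
    HasValueAt f X y →
      HasValueAt f
        (powDiag t (fun i : Fin n => n - (i : ℕ)) * X * powDiag s (fun i : Fin n => (i : ℕ) + 1))
        (t ^ ξ * s ^ ξ' * y)

end GCn

end

noncomputable section

namespace GCn

/-! ### Semi-invariants of a family of endomorphisms of a field -/

section SemiInvariant

variable {T K : Type*} [Field K]

/-! Give `x_{ij}` the weight `a + b i + c j`, with `a`, `b`, `c` integers. The rescaling `x_{ij} ↦ t
^ (a + b i + c j) x_{ij}` extends to the field of rational functions, and it suffices that every
cluster variable is an eigenvector with eigenvalue `t ^ d`. Overall scaling, the row action and the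
column action are the cases `(1,0,0)`, `(n+1,-1,0)` and `(0,0,1)`.

Eigenvectors survive mutation once all terms of each exchange relation have equal degree
(`IsGraded.exchangeRHS`). For this to propagate, it must hold for the new seed too
(`IsGraded.mutate`): the condition at `j ≠ k` after mutation at `k` is the old one at `j` plus a
multiple of the old one at `k`. The path weights of the mutation rule make the floors in the frozen
exponents shift by integers.

It remains to grade the initial seed (`initialSeed_isGraded`). Its variables are entries,
determinants whose entries have degree (row weight) + (column weight), or coefficients of such a
determinant in `λ`, so their degrees are explicit polynomials in the indices. Equality of degrees in
the exchange relations is then a polynomial identity on each boundary stratum of the quiver. At the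
special vertex `(1,1)` the degrees of the `c_r` compensate for the floors (`balance_phi_one_one`).
-/

/-- `f` is a semi-invariant of degree `d` of the endomorphisms `σ t` with multipliers `τ t`. -/
def IsSemiInvariant (σ : T → K →+* K) (τ : T → K) (f : K) (d : ℤ) : Prop :=
  ∀ t, σ t f = τ t ^ d * f

namespace IsSemiInvariant

variable {σ : T → K →+* K} {τ : T → K} {f g : K} {d e : ℤ}

theorem one : IsSemiInvariant σ τ 1 0 := fun t => by simp

theorem mul (hτ : ∀ t, τ t ≠ 0) (hf : IsSemiInvariant σ τ f d) (hg : IsSemiInvariant σ τ g e) :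
    IsSemiInvariant σ τ (f * g) (d + e) := fun t => by
  rw [map_mul, hf t, hg t, zpow_add₀ (hτ t)]; ring

theorem zpow (hf : IsSemiInvariant σ τ f d) (m : ℤ) :
    IsSemiInvariant σ τ (f ^ m) (m * d) := fun t => by
  rw [map_zpow₀, hf t, mul_zpow, ← zpow_mul, mul_comm d]

theorem pow (hf : IsSemiInvariant σ τ f d) (m : ℕ) :
    IsSemiInvariant σ τ (f ^ m) (m * d) := by
  simpa using hf.zpow m

theorem div (hτ : ∀ t, τ t ≠ 0) (hf : IsSemiInvariant σ τ f d) (hg : IsSemiInvariant σ τ g e) :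
    IsSemiInvariant σ τ (f / g) (d - e) := by
  have h := hf.mul hτ (hg.zpow (-1))
  rwa [zpow_neg_one, ← div_eq_mul_inv, neg_one_mul, ← sub_eq_add_neg] at h

theorem prod (hτ : ∀ t, τ t ≠ 0) {ι : Type*} (s : Finset ι) {f : ι → K} {d : ι → ℤ}
    (hf : ∀ i ∈ s, IsSemiInvariant σ τ (f i) (d i)) :
    IsSemiInvariant σ τ (∏ i ∈ s, f i) (∑ i ∈ s, d i) := by
  classical
  induction s using Finset.induction_on with
  | empty => simpa using one
  | insert a s ha ih =>
    rw [Finset.prod_insert ha, Finset.sum_insert ha]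
    exact (hf a (Finset.mem_insert_self a s)).mul hτ
      (ih fun i hi => hf i (Finset.mem_insert_of_mem hi))

theorem sum {ι : Type*} (s : Finset ι) {f : ι → K}
    (hf : ∀ i ∈ s, IsSemiInvariant σ τ (f i) d) :
    IsSemiInvariant σ τ (∑ i ∈ s, f i) d := fun t => by
  rw [map_sum, Finset.mul_sum]
  exact Finset.sum_congr rfl fun i hi => hf i hi t

end IsSemiInvariant

end SemiInvariant

/-! ### Graded seeds -/

/-- The two floors in a generalized exchange relation combine into the floor of a signed number. -/
theorem floor_add_floor {d r a b : ℕ} (hd : 0 < d) (hr : r ≤ d) (h : a = 0 ∨ b = 0) :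
    ((r * a / d : ℕ) : ℤ) + ((d - r) * b / d : ℕ) = b + (r * ((a : ℤ) - b)) / d := by
  have hd' : (d : ℤ) ≠ 0 := by exact_mod_cast hd.ne'
  push_cast [Nat.cast_sub hr]
  rcases h with rfl | rfl
  · rw [show ((d : ℤ) - r) * b = r * (((0 : ℕ) : ℤ) - b) + d * b by push_cast; ring,
      Int.add_mul_ediv_left _ _ hd']
    simp [add_comm]
  · simp

namespace ExtendedSeed

variable {T M F K : Type*} [Fintype M] [Fintype F] [Field K]

/-- The number of arrows `i → j` minus the number of arrows `j → i`. -/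
def netArrows (S : ExtendedSeed M F K) (i j : M ⊕ F) : ℤ := S.arrows i j - S.arrows j i

/-- The difference of the degrees of the `r`-th and of the `0`-th term of the exchange relation
at `k`. -/
def imbalance (S : ExtendedSeed M F K) (deg : M ⊕ F → ℤ) (k : M) (r : ℕ) : ℤ :=
  ∑ i, S.coeff k r i * deg (.inr i) + r * ∑ i, S.netArrows (.inl k) (.inl i) * deg (.inl i) +
    ∑ i, (r * S.netArrows (.inl k) (.inr i)) / S.mult k * deg (.inr i)

/-- The degree of the `0`-th term of the exchange relation at `k`. -/
def degIn (S : ExtendedSeed M F K) (deg : M ⊕ F → ℤ) (k : M) : ℤ :=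
  S.mult k * ∑ i, (S.arrows (.inl i) (.inl k) : ℤ) * deg (.inl i) +
    ∑ i, (S.arrows (.inr i) (.inl k) : ℤ) * deg (.inr i)

/-- The extended cluster consists of semi-invariants of degrees `deg`, and all generalized exchange
relations are homogeneous. -/
structure IsGraded (S : ExtendedSeed M F K) (σ : T → K →+* K) (τ : T → K) (deg : M ⊕ F → ℤ) :
    Prop where
  mult_pos : ∀ k, 0 < S.mult k
  no_two_cycles : ∀ i j, S.arrows i j = 0 ∨ S.arrows j i = 0
  semiInvariant : ∀ v, IsSemiInvariant σ τ (S.var v) (deg v)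
  imbalance_eq_zero : ∀ k, ∀ r ≤ S.mult k, S.imbalance deg k r = 0

namespace IsGraded

variable {S : ExtendedSeed M F K} {σ : T → K →+* K} {τ : T → K} {deg : M ⊕ F → ℤ}

/-- The `r`-th summand has degree `degIn` plus `imbalance`, and the latter vanishes, so all summands
share one degree. -/
theorem exchangeRHS (hS : S.IsGraded σ τ deg) (hτ : ∀ t, τ t ≠ 0) (k : M) :
    IsSemiInvariant σ τ (S.exchangeRHS k) (S.degIn deg k) := by
  refine IsSemiInvariant.sum _ fun r hr => ?_
  have hr : r ≤ S.mult k := Nat.lt_succ_iff.mp (Finset.mem_range.mp hr)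
  have h1 : IsSemiInvariant σ τ (S.exchangeCoeff k r) _ :=
    IsSemiInvariant.prod hτ _ fun i _ => (hS.semiInvariant (.inr i)).zpow (S.coeff k r i)
  have h2 : IsSemiInvariant σ τ (S.uOut k) _ :=
    IsSemiInvariant.prod hτ _ fun i _ => (hS.semiInvariant (.inl i)).pow _
  have h3 : IsSemiInvariant σ τ (S.vOut k r) _ :=
    IsSemiInvariant.prod hτ _ fun i _ => (hS.semiInvariant (.inr i)).pow _
  have h4 : IsSemiInvariant σ τ (S.uIn k) _ :=
    IsSemiInvariant.prod hτ _ fun i _ => (hS.semiInvariant (.inl i)).pow _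
  have h5 : IsSemiInvariant σ τ (S.vIn k (S.mult k - r)) _ :=
    IsSemiInvariant.prod hτ _ fun i _ => (hS.semiInvariant (.inr i)).pow _
  have h := (((h1.mul hτ (h2.pow r)).mul hτ h3).mul hτ (h4.pow (S.mult k - r))).mul hτ h5
  convert h using 1
  have hF : ∑ i, (((r * S.arrows (.inl k) (.inr i) / S.mult k : ℕ) : ℤ) * deg (.inr i)) +
      ∑ i, ((((S.mult k - r) * S.arrows (.inr i) (.inl k) / S.mult k : ℕ) : ℤ) * deg (.inr i)) =
      ∑ i, (S.arrows (.inr i) (.inl k) : ℤ) * deg (.inr i) +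
      ∑ i, (r * S.netArrows (.inl k) (.inr i)) / S.mult k * deg (.inr i) := by
    rw [← Finset.sum_add_distrib, ← Finset.sum_add_distrib]
    refine Finset.sum_congr rfl fun i _ => ?_
    rw [← add_mul, ← add_mul, floor_add_floor (hS.mult_pos k) hr (hS.no_two_cycles _ _)]
    rfl
  have hE := hS.imbalance_eq_zero k r hr
  have hM : ∑ i, S.netArrows (.inl k) (.inl i) * deg (.inl i) =
      ∑ i, (S.arrows (.inl k) (.inl i) : ℤ) * deg (.inl i) -
      ∑ i, (S.arrows (.inl i) (.inl k) : ℤ) * deg (.inl i) := by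
    rw [← Finset.sum_sub_distrib]
    exact Finset.sum_congr rfl fun i _ => by rw [netArrows, sub_mul]
  rw [imbalance, hM] at hE
  rw [degIn, Nat.cast_sub hr]
  linear_combination -hE - hF

theorem arrows_self (hS : S.IsGraded σ τ deg) (i : M ⊕ F) : S.arrows i i = 0 :=
  (hS.no_two_cycles i i).elim id id

variable [DecidableEq M] [DecidableEq F]

/-- Cancelling 2-cycles by truncated subtraction does not affect the signed arrow count, so the path
contributions simply add up. -/
theorem netArrows_mutate_of_ne (k : M) {i j : M ⊕ F} (hi : i ≠ .inl k) (hj : j ≠ .inl k) :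
    (S.mutate k).netArrows i j = S.netArrows i j +
      (S.pathWeight k i j * (S.arrows i (.inl k) * S.arrows (.inl k) j) -
        S.pathWeight k j i * (S.arrows j (.inl k) * S.arrows (.inl k) i) : ℤ) := by
  simp only [netArrows, mutate, hi, hj, or_self, if_false]
  have h : ∀ a b : ℕ, (((a - b : ℕ) : ℤ) - (b - a : ℕ)) = a - b := by intro a b; omega
  rw [h]
  simp only [arrowsWithPaths]
  push_cast
  ring

theorem netArrows_mutate_of_eq (k : M) {i j : M ⊕ F} (h : i = .inl k ∨ j = .inl k) :
    (S.mutate k).netArrows i j = - S.netArrows i j := by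
  simp only [netArrows, mutate, h, h.symm, if_true]
  ring

/-- Cluster mutation preserves gradings. -/
theorem mutate (hS : S.IsGraded σ τ deg) (hτ : ∀ t, τ t ≠ 0) (k : M) :
    (S.mutate k).IsGraded σ τ
      (Function.update deg (.inl k) (S.degIn deg k - deg (.inl k))) where
  mult_pos := hS.mult_pos
  no_two_cycles := by
    intro i j
    by_cases h : i = .inl k ∨ j = .inl k
    · simpa [ExtendedSeed.mutate, h, h.symm] using (hS.no_two_cycles i j).symm
    · have h' : ¬ (j = .inl k ∨ i = .inl k) := fun h'' => h h''.symm
      simp only [ExtendedSeed.mutate, h, h', if_false]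
      omega
  semiInvariant := by
    intro v
    by_cases h : v = .inl k
    · subst h
      simpa [ExtendedSeed.mutate] using
        (hS.exchangeRHS hτ k).div hτ (hS.semiInvariant (.inl k))
    · simpa [ExtendedSeed.mutate, h] using hS.semiInvariant v
  imbalance_eq_zero := by
    intro j r hr
    change r ≤ S.mult j at hr
    have hd : (S.mult j : ℤ) ≠ 0 := by exact_mod_cast (hS.mult_pos j).ne'
    by_cases hjk : j = k
    · subst hjk
      -- At the mutated vertex the arrows and the string are reversed, so the new `r`-th term is the
      -- old one with index `mult - r`. The new imbalance is the difference of the old ones at `mult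
      -- - r` and at `mult`.
      have h1 := hS.imbalance_eq_zero j (S.mult j - r) (Nat.sub_le _ _)
      have h2 := hS.imbalance_eq_zero j (S.mult j) le_rfl
      simp only [imbalance, S.coeff_mult, Nat.cast_sub hr] at h1 h2
      have hM : ∑ i, (S.mutate j).netArrows (.inl j) (.inl i) *
            Function.update deg (.inl j) (S.degIn deg j - deg (.inl j)) (.inl i) =
          - ∑ i, S.netArrows (.inl j) (.inl i) * deg (.inl i) := by
        rw [← Finset.sum_neg_distrib]
        refine Finset.sum_congr rfl fun i _ => ?_
        rw [netArrows_mutate_of_eq j (Or.inl rfl)]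
        by_cases hij : i = j
        · subst hij; simp [netArrows]
        · simp [hij]
      have hF : ∑ i, ((S.mult j - r : ℤ) * S.netArrows (.inl j) (.inr i)) / S.mult j *
            deg (.inr i) =
          ∑ i, (S.mult j * S.netArrows (.inl j) (.inr i)) / S.mult j * deg (.inr i) +
          ∑ i, (r * (S.mutate j).netArrows (.inl j) (.inr i)) / S.mult j * deg (.inr i) := by
        rw [← Finset.sum_add_distrib]
        refine Finset.sum_congr rfl fun i _ => ?_
        rw [netArrows_mutate_of_eq j (Or.inl rfl), ← add_mul, Int.mul_ediv_cancel_left _ hd,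
          show (S.mult j - r : ℤ) * S.netArrows (.inl j) (.inr i) =
            r * -S.netArrows (.inl j) (.inr i) + S.mult j * S.netArrows (.inl j) (.inr i) by ring,
          Int.add_mul_ediv_left _ _ hd, add_comm]
      rw [imbalance, hM]
      simp only [ExtendedSeed.mutate, if_true, ne_eq, reduceCtorEq, not_false_eq_true,
        Function.update_of_ne] at hF ⊢
      simp only [Pi.zero_apply, zero_mul, Finset.sum_const_zero, zero_add] at h2
      linear_combination h1 - h2 - hF
    · have h1 := hS.imbalance_eq_zero j r hr
      -- For the last term at `k` the string is trivial and the floors are exact, so `h2` is a plain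
      -- linear relation among the degrees of the neighbours of `k`.
      have h2 := hS.imbalance_eq_zero k (S.mult k) le_rfl
      simp only [imbalance, S.coeff_mult, Pi.zero_apply, zero_mul, Finset.sum_const_zero,
        zero_add] at h1 h2
      have hkd : (S.mult k : ℤ) ≠ 0 := by exact_mod_cast (hS.mult_pos k).ne'
      simp only [Int.mul_ediv_cancel_left _ hkd, netArrows, sub_mul, Finset.sum_sub_distrib] at h2
      have hjk' : (Sum.inl j : M ⊕ F) ≠ .inl k := fun h => hjk (Sum.inl_injective h)
      set a : ℤ := (S.arrows (.inl j) (.inl k) : ℤ) with ha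
      set b : ℤ := (S.arrows (.inl k) (.inl j) : ℤ) with hb
      -- The arrows between `j` and `k` change sign while the degree at `k` becomes `degIn - deg k`:
      -- the old contribution of `k` reappears, with the extra term `-(a - b) * degIn`.
      have hM : ∑ i, (S.mutate k).netArrows (.inl j) (.inl i) *
            Function.update deg (.inl k) (S.degIn deg k - deg (.inl k)) (.inl i) =
          ∑ i, S.netArrows (.inl j) (.inl i) * deg (.inl i) +
          S.mult k * (a * ∑ i, (S.arrows (.inl k) (.inl i) : ℤ) * deg (.inl i) -
            b * ∑ i, (S.arrows (.inl i) (.inl k) : ℤ) * deg (.inl i)) -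
          (a - b) * S.degIn deg k := by
        rw [Finset.mul_sum, Finset.mul_sum, ← Finset.sum_sub_distrib, Finset.mul_sum,
          ← Finset.sum_add_distrib,
          ← Finset.add_sum_erase _ _ (Finset.mem_univ k),
          ← Finset.add_sum_erase (a := k) (s := Finset.univ)
            (f := fun i => S.netArrows (.inl j) (.inl i) * deg (.inl i) + _)
            (Finset.mem_univ k)]
        have : ∀ i ∈ Finset.univ.erase k, (S.mutate k).netArrows (.inl j) (.inl i) *
            Function.update deg (.inl k) (S.degIn deg k - deg (.inl k)) (.inl i) =
            S.netArrows (.inl j) (.inl i) * deg (.inl i) +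
            S.mult k * (a * ((S.arrows (.inl k) (.inl i) : ℤ) * deg (.inl i)) -
              b * ((S.arrows (.inl i) (.inl k) : ℤ) * deg (.inl i))) := by
          intro i hi
          have hi : (Sum.inl i : M ⊕ F) ≠ .inl k :=
            fun h => (Finset.ne_of_mem_erase hi) (Sum.inl_injective h)
          rw [netArrows_mutate_of_ne k hjk' hi, Function.update_of_ne hi]
          simp only [pathWeight]
          ring
        rw [Finset.sum_congr rfl this, netArrows_mutate_of_eq k (Or.inr rfl),
          Function.update_self, hS.arrows_self]
        simp only [netArrows, ← ha, ← hb]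
        push_cast
        ring
      -- Paths between mutable `j` and a frozen vertex carry weight `mult j`, which is precisely the
      -- divisor, so they come out of the floor as integers.
      have hF : ∑ i, (r * (S.mutate k).netArrows (.inl j) (.inr i)) / S.mult j * deg (.inr i) =
          ∑ i, (r * S.netArrows (.inl j) (.inr i)) / S.mult j * deg (.inr i) +
          r * (a * ∑ i, (S.arrows (.inl k) (.inr i) : ℤ) * deg (.inr i) -
            b * ∑ i, (S.arrows (.inr i) (.inl k) : ℤ) * deg (.inr i)) := by
        rw [Finset.mul_sum, Finset.mul_sum, ← Finset.sum_sub_distrib, Finset.mul_sum,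
          ← Finset.sum_add_distrib]
        refine Finset.sum_congr rfl fun i _ => ?_
        rw [netArrows_mutate_of_ne k hjk' (by simp)]
        simp only [pathWeight]
        rw [show (r : ℤ) * (S.netArrows (.inl j) (.inr i) + ((S.mult j : ℤ) *
            ((S.arrows (.inl j) (.inl k) : ℤ) * (S.arrows (.inl k) (.inr i) : ℤ)) -
            (S.mult j : ℤ) * ((S.arrows (.inr i) (.inl k) : ℤ) * (S.arrows (.inl k) (.inl j) : ℤ)))) = r * S.netArrows (.inl j) (.inr i) +
            S.mult j * (r * (a * S.arrows (.inl k) (.inr i) - b * S.arrows (.inr i) (.inl k))) by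
          rw [ha, hb]; ring, Int.add_mul_ediv_left _ _ hd]
        ring
      rw [imbalance, hM]
      simp only [ne_eq, reduceCtorEq, not_false_eq_true, Function.update_of_ne]
      rw [show (S.mutate k).mult j = S.mult j from rfl, hF]
      simp only [ExtendedSeed.mutate, hjk, if_false, degIn]
      linear_combination h1 + r * a * h2

/-- All cluster variables of a graded seed are semi-invariants. -/
theorem exists_isSemiInvariant (hS : S.IsGraded σ τ deg) (hτ : ∀ t, τ t ≠ 0) {f : K}
    (hf : f ∈ S.clusterVariables) : ∃ d, IsSemiInvariant σ τ f d := by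
  obtain ⟨S', hS', v, rfl⟩ := hf
  have : ∃ deg', S'.IsGraded σ τ deg' := by
    induction hS' with
    | refl => exact ⟨deg, hS⟩
    | tail _ h ih =>
      obtain ⟨deg', h'⟩ := ih
      obtain ⟨k, rfl⟩ := h
      exact ⟨_, h'.mutate hτ k⟩
  obtain ⟨deg', h'⟩ := this
  exact ⟨_, h'.semiInvariant v⟩

end IsGraded

end ExtendedSeed

/-! ### Determinants of semi-invariants -/

section Determinants

variable {T K : Type*} [Field K] {σ : T → K →+* K} {τ : T → K}

theorem prod_zpow_eq_zpow_sum {x : K} (hx : x ≠ 0) {ι : Type*} (s : Finset ι) (f : ι → ℤ) :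
    ∏ i ∈ s, x ^ f i = x ^ ∑ i ∈ s, f i := by
  classical
  induction s using Finset.induction_on with
  | empty => simp
  | insert a s ha ih => rw [Finset.prod_insert ha, Finset.sum_insert ha, zpow_add₀ hx, ih]

/-- Zero has every degree at once, so the zero entries of the block matrices impose no conditions on
row and column weights. -/
theorem IsSemiInvariant.zero (d : ℤ) : IsSemiInvariant σ τ 0 d := fun t => by simp

/-- The endomorphism multiplies row `i` by `τ ^ ρ i` and column `j` by `τ ^ κ j`, and these factors
come out of the determinant. -/
theorem IsSemiInvariant.det (hτ : ∀ t, τ t ≠ 0) {ι : Type*} [Fintype ι] [DecidableEq ι]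
    {A : Matrix ι ι K} {ρ κ : ι → ℤ} (hA : ∀ i j, IsSemiInvariant σ τ (A i j) (ρ i + κ j)) :
    IsSemiInvariant σ τ A.det (∑ i, (ρ i + κ i)) := fun t => by
  have h : (σ t).mapMatrix A =
      Matrix.of fun i j => τ t ^ ρ i * (Matrix.of fun i j => τ t ^ κ j * A i j) i j := by
    ext i j
    simp [hA i j t, zpow_add₀ (hτ t), mul_assoc]
  rw [RingHom.map_det, h, Matrix.det_mul_column, Matrix.det_mul_row, prod_zpow_eq_zpow_sum (hτ t),
    prod_zpow_eq_zpow_sum (hτ t), Finset.sum_add_distrib, zpow_add₀ (hτ t), mul_assoc]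

/-- The entries of `X` are semi-invariants whose degrees are affine functions of the indices. -/
def IsAffineGraded {n : ℕ} (σ : T → K →+* K) (τ : T → K) (a b c : ℤ)
    (X : Matrix (Fin n) (Fin n) K) : Prop :=
  ∀ i j : Fin n, IsSemiInvariant σ τ (X i j) (a + b * ((i : ℤ) + 1) + c * ((j : ℤ) + 1))

variable {n : ℕ} {a b c : ℤ} {X : Matrix (Fin n) (Fin n) K}

theorem IsAffineGraded.entry (hX : IsAffineGraded σ τ a b c X) (i j : ℕ) :
    IsSemiInvariant σ τ (entry X i j) (a + b * i + c * j) := by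
  unfold GCn.entry
  split_ifs with h
  · convert hX ⟨i - 1, by omega⟩ ⟨j - 1, by omega⟩ using 1
    rw [Nat.cast_sub h.1.1, Nat.cast_sub h.2.1]
    simp
  · exact .zero _

theorem entry_zero_left (X : Matrix (Fin n) (Fin n) K) (j : ℕ) : entry X 0 j = 0 := by
  simp [entry]

theorem entry_zero_right (X : Matrix (Fin n) (Fin n) K) (i : ℕ) : entry X i 0 = 0 := by
  simp [entry]

/-- The shift `s` of a row is absorbed into its row weight, leaving a column weight independent of
the row. Positions left of the shifted row truncate to column index `0`, where `entry` vanishes. -/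
theorem IsAffineGraded.entry_shift (hX : IsAffineGraded σ τ a b c X) (i j s : ℕ) :
    IsSemiInvariant σ τ (GCn.entry X i (j + 1 - s)) ((a + b * i - c * s) + c * (j + 1)) := by
  rcases Nat.lt_or_ge (j + 1) s with h | h
  · rw [Nat.sub_eq_zero_of_le h.le, entry_zero_right]
    exact .zero _
  · convert hX.entry i (j + 1 - s) using 1
    rw [Nat.cast_sub h]
    push_cast
    ring

/-- Degrees are recorded doubled from here on: `n(n+1)/2` and its relatives then become polynomials
with integer coefficients, accessible to `ring`. -/
theorem IsAffineGraded.det (hτ : ∀ t, τ t ≠ 0) (hX : IsAffineGraded σ τ a b c X) :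
    ∃ d, 2 * d = 2 * n * a + (b + c) * n * (n + 1) ∧ IsSemiInvariant σ τ X.det d := by
  refine ⟨_, ?_, IsSemiInvariant.det hτ (ρ := fun i : Fin n => a + b * ((i : ℤ) + 1))
    (κ := fun j : Fin n => c * ((j : ℤ) + 1)) hX⟩
  rw [← Finset.sum_range (fun i => a + b * ((i : ℤ) + 1) + c * ((i : ℤ) + 1))]
  have h : ∀ m : ℕ, 2 * ∑ i ∈ Finset.range m, (a + b * ((i : ℤ) + 1) + c * ((i : ℤ) + 1)) =
      2 * m * a + (b + c) * m * (m + 1) := by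
    intro m
    induction m with
    | zero => simp
    | succ m ih => rw [Finset.sum_range_succ, mul_add, ih]; push_cast; ring
  exact h n

/-- For common row and column weights, the entries of `A` exceed those of `B` by the constant degree
`b - c`. So rescaling acts on `det (λ A + B)` as a scalar times the substitution `λ ↦ τ ^ (b - c)
λ`, and the coefficient at `λ ^ r` gains `(b - c) r`. -/
theorem IsAffineGraded.cFun (hτ : ∀ t, τ t ≠ 0) (hX : IsAffineGraded σ τ a b c X) (r : ℕ) :
    ∃ d, 2 * d = 2 * (n + 1) * a + b * (n * (n + 1) + 2 + 2 * r) +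
      c * (n * (n + 1) + 2 * n - 2 * r) ∧ IsSemiInvariant σ τ (cFun X r) d := by
  set ρ : Fin (n + 1) → ℤ := fun i => a + b * i with hρ
  -- The first column of `B` is the last column of `X` placed one row higher than the copy of `X`
  -- beside it; hence the exceptional weight `b + c * n`.
  set κ : Fin (n + 1) → ℤ := fun j => if (j : ℕ) = 0 then b + c * n else c * j with hκ
  refine ⟨∑ i, (ρ i + κ i) + (b - c) * r, ?_, fun t => ?_⟩
  · rw [← Finset.sum_range (fun i => (a + b * (i : ℤ)) + if i = 0 then b + c * n else c * (i : ℤ)),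
      Finset.sum_range_succ']
    have : ∀ m : ℕ, 2 * ∑ i ∈ Finset.range m, (a + b * ((i + 1 : ℕ) : ℤ) +
        if i + 1 = 0 then b + c * n else c * ((i + 1 : ℕ) : ℤ)) =
        2 * m * a + (b + c) * m * (m + 1) := by
      intro m
      induction m with
      | zero => simp
      | succ m ih => rw [Finset.sum_range_succ, mul_add, ih]; simp; ring
    rw [mul_add, mul_add, this]
    simp
    ring
  · have hA : ∀ i j, σ t (aMatrix X i j) = τ t ^ (ρ i + κ j + (b - c)) * aMatrix X i j := by
      intro i j
      simp only [aMatrix, Matrix.of_apply]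
      by_cases hj : (j : ℕ) = 0
      · simp [hj, entry_zero_right]
      · rw [hX.entry _ _ t]
        congr 2
        simp only [hρ, hκ, hj, if_false]
        rw [Nat.cast_sub (Nat.one_le_iff_ne_zero.mpr hj)]
        push_cast
        ring
    have hB : ∀ i j, σ t (bMatrix X i j) = τ t ^ (ρ i + κ j) * bMatrix X i j := by
      intro i j
      simp only [bMatrix, Matrix.of_apply]
      split_ifs with hj
      · rw [hX.entry _ _ t]
        congr 2
        simp only [hρ, hκ, hj, if_true]
        push_cast
        ring
      · rw [hX.entry _ _ t]
        congr 2
        simp only [hρ, hκ, hj, if_false]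
    set P := (Polynomial.X : Polynomial K) • (aMatrix X).map Polynomial.C +
      (bMatrix X).map Polynomial.C with hP
    have hprod : ∀ f : Fin (n + 1) → ℤ,
        ∏ i, (Polynomial.C (τ t ^ f i) : Polynomial K) = Polynomial.C (τ t ^ ∑ i, f i) := by
      intro f
      rw [← map_prod, prod_zpow_eq_zpow_sum (hτ t)]
    have hdet : P.det.map (σ t) = Polynomial.C (τ t ^ ∑ i, (ρ i + κ i)) *
        P.det.comp (Polynomial.C (τ t ^ (b - c)) * Polynomial.X) := by
      have h1 : (Polynomial.mapRingHom (σ t)).mapMatrix P =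
          Matrix.of fun i j => Polynomial.C (τ t ^ ρ i) *
            (Matrix.of fun i j => Polynomial.C (τ t ^ κ j) *
              (Polynomial.compRingHom (Polynomial.C (τ t ^ (b - c)) * Polynomial.X)).mapMatrix P
                i j) i j := by
        ext1 i j
        simp only [RingHom.mapMatrix_apply, Matrix.map_apply, hP, Matrix.add_apply,
          Matrix.smul_apply, smul_eq_mul, Matrix.of_apply, Polynomial.coe_mapRingHom,
          Polynomial.map_add, Polynomial.map_mul, Polynomial.map_X, Polynomial.map_C, hA, hB,
          Polynomial.coe_compRingHom_apply, Polynomial.add_comp, Polynomial.mul_comp,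
          Polynomial.X_comp, Polynomial.C_comp, zpow_add₀ (hτ t), Polynomial.C_mul]
        ring
      have h2 := RingHom.map_det (Polynomial.mapRingHom (σ t)) P
      rw [h1, Matrix.det_mul_column, Matrix.det_mul_row, ← RingHom.map_det, hprod, hprod] at h2
      rw [Polynomial.coe_mapRingHom, Polynomial.coe_compRingHom_apply] at h2
      rw [h2, Finset.sum_add_distrib (f := ρ) (g := κ), zpow_add₀ (hτ t), Polynomial.C_mul, mul_assoc]
    have hc := congrArg (fun p : Polynomial K => p.coeff r) hdet
    simp only [Polynomial.coeff_map, Polynomial.coeff_C_mul, Polynomial.comp_C_mul_X_coeff] at hc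
    unfold GCn.cFun
    rw [map_mul, ← hP, hc, map_pow, map_neg, map_one, zpow_add₀ (hτ t), zpow_mul, zpow_natCast]
    ring

theorem sum_staircaseRows (f : ℕ × ℕ → ℤ) (L : List (List ℕ)) :
    ((staircaseRows L).map f).sum =
      (L.zipIdx.map fun p => (p.1.map fun i => f (i, p.2)).sum).sum := by
  unfold staircaseRows
  rw [List.map_flatMap, List.flatMap_def, List.sum_flatten, List.map_map]
  simp [Function.comp_def]

end Determinants

/-! ### Summation formulas for row and column weights -/

section Sums

theorem two_mul_sum_range_affine (x y : ℤ) (N : ℕ) :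
    2 * ∑ t ∈ Finset.range N, (x + y * (t : ℤ)) = 2 * N * x + y * N * (N - 1) := by
  induction N with
  | zero => simp
  | succ N ih => rw [Finset.sum_range_succ, mul_add, ih]; push_cast; ring

theorem sum_range_getD {α : Type*} (f : α → ℤ) (d : α) (L : List α) :
    ∑ r ∈ Finset.range L.length, f (L.getD r d) = (L.map f).sum := by
  induction L with
  | nil => simp
  | cons x L ih =>
    rw [List.length_cons, Finset.sum_range_succ', List.map_cons, List.sum_cons, ← ih, add_comm]
    simp

theorem sum_map_range' (f : ℕ → ℤ) (s l : ℕ) :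
    ((List.range' s l).map f).sum = ∑ t ∈ Finset.range l, f (s + t) := by
  induction l with
  | zero => simp
  | succ l ih => rw [List.range'_1_concat, List.map_append, List.sum_append, ih,
      Finset.sum_range_succ]; simp

theorem sum_zipIdx_replicate {α : Type*} (g : α × ℕ → ℤ) (x : α) (k : ℕ) :
    ((List.replicate k x).zipIdx.map g).sum = ∑ s ∈ Finset.range k, g (x, s) := by
  induction k with
  | zero => simp
  | succ k ih => rw [List.replicate_succ', List.zipIdx_append, List.map_append, List.sum_append,
      ih, Finset.sum_range_succ]; simp

theorem sum_range_mul (f : ℕ → ℤ) (p q : ℕ) :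
    ∑ r ∈ Finset.range (p * q), f r =
      ∑ s ∈ Finset.range p, ∑ t ∈ Finset.range q, f (s * q + t) := by
  induction p with
  | zero => simp
  | succ p ih => rw [Nat.succ_mul, Finset.sum_range_add, ih, Finset.sum_range_succ]

/-- Counting rows from the bottom makes the ranges for the trailing minors nested, so that their
degrees can be found by induction on the size. -/
theorem sum_trailing (G : ℕ → ℤ) {N m : ℕ} (h : m ≤ N) :
    ∑ x : {r : Fin N // N - m ≤ (r : ℕ)}, G x.1 = ∑ u ∈ Finset.range m, G (N - 1 - u) := by
  symm
  refine Finset.sum_bij (fun u hu => ⟨⟨N - 1 - u, ?_⟩, ?_⟩) ?_ ?_ ?_ ?_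
  · have := Finset.mem_range.mp hu; omega
  · have := Finset.mem_range.mp hu; simp only; omega
  · simp
  · intro u hu v hv huv
    have h1 := Finset.mem_range.mp hu
    have h2 := Finset.mem_range.mp hv
    simp only [Subtype.mk.injEq, Fin.mk.injEq] at huv
    omega
  · rintro ⟨⟨r, hr⟩, hr'⟩ -
    simp only at hr'
    refine ⟨N - 1 - r, Finset.mem_range.mpr (by omega), ?_⟩
    simp only [Subtype.mk.injEq, Fin.mk.injEq]
    omega
  · intros; rfl

end Sums

/-! ### Degrees of the functions `g`, `f` and `φ` -/

section Degrees

variable {T K : Type*} [Field K] {σ : T → K →+* K} {τ : T → K}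
  {n : ℕ} {a b c : ℤ} {X : Matrix (Fin n) (Fin n) K}

theorem IsAffineGraded.gFun (hτ : ∀ t, τ t ≠ 0) (hX : IsAffineGraded σ τ a b c X) {i j : ℕ}
    (hj : 2 ≤ j) (hij : j ≤ i) (hi : i < n) :
    ∃ d : ℤ, 2 * d = 2 * a * (n + j - 1) +
      b * (2 * (j - 2) * (n + 1) + 4 + (i + 1 - j) * (2 * n + j - i) + (n - i) * (n + i + 1)) +
      c * ((n + j - 1) * (n + j) -
        2 * ((j - 2) * (j - 3) + (j - 2) * (i + 2 - j) + (j - 1) * (n - i + 1))) ∧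
      IsSemiInvariant σ τ (gFun X i j) d := by
  set L := staircaseRows (List.replicate (j - 2) [1, n] ++
    [1 :: List.range' (n + j - i) (i + 1 - j), 1 :: List.range' (i + 1) (n - i)]) with hL
  have hsum : ∀ f : ℕ × ℕ → ℤ, (L.map f).sum =
      ∑ s ∈ Finset.range (j - 2), (f (1, s) + f (n, s)) +
        (f (1, j - 2) + ∑ t ∈ Finset.range (i + 1 - j), f (n + j - i + t, j - 2)) +
        (f (1, j - 1) + ∑ t ∈ Finset.range (n - i), f (i + 1 + t, j - 1)) := by
    intro f
    rw [hL, sum_staircaseRows, List.zipIdx_append, List.map_append, List.sum_append,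
      sum_zipIdx_replicate]
    simp only [List.map_cons, List.map_nil, List.sum_cons, List.sum_nil, add_zero,
      List.length_replicate, List.zipIdx_cons, List.zipIdx_nil, zero_add,
      sum_map_range' (fun x => f (x, j - 2)), show j - 2 + 1 = j - 1 by omega,
      sum_map_range' (fun x => f (x, j - 1))]
    ring
  -- The constant function `1` in `hsum` counts the rows; by the equality no index in the degree sum
  -- falls back on the default of `getD`.
  have hlen : n + j - 1 = L.length := by
    have h := hsum fun _ => 1
    simp only [List.map_const', List.sum_replicate, Finset.sum_const, Finset.card_range] at h
    simp only [nsmul_eq_mul, mul_one] at h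
    push_cast at h
    omega
  refine ⟨_, ?_, IsSemiInvariant.det hτ
    (ρ := fun r : Fin (n + j - 1) => a + b * ((L.getD r (0, 0)).1 : ℤ) - c * (L.getD r (0, 0)).2)
    (κ := fun s : Fin (n + j - 1) => c * ((s : ℕ) + 1)) fun r s => ?_⟩
  · rw [Finset.sum_add_distrib,
      ← Finset.sum_range (fun r => a + b * ((L.getD r (0, 0)).1 : ℤ) - c * (L.getD r (0, 0)).2),
      ← Finset.sum_range (fun s => c * ((s : ℤ) + 1)), hlen,
      sum_range_getD (fun q : ℕ × ℕ => a + b * (q.1 : ℤ) - c * q.2), hsum, ← hlen]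
    -- Writing `j`, `i`, `n` as successive sums removes all truncated subtractions.
    obtain ⟨j, rfl⟩ := Nat.exists_eq_add_of_le' hj
    obtain ⟨i, rfl⟩ := Nat.exists_eq_add_of_le hij
    obtain ⟨n, rfl⟩ := Nat.exists_eq_add_of_lt hi
    have h1 : ∑ s ∈ Finset.range (j + 2 - 2), (a + b * ((1 : ℕ) : ℤ) - c * s +
        (a + b * ((j + 2 + i + n + 1 : ℕ) : ℤ) - c * s)) = ∑ s ∈ Finset.range j,
          ((2 * a + b * (j + i + n + 4)) + (-2 * c) * s) := by
      refine Finset.sum_congr rfl fun s _ => ?_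
      push_cast
      ring
    have h2 : ∑ t ∈ Finset.range (j + 2 + i + 1 - (j + 2)), (a +
        b * ((j + 2 + i + n + 1 + (j + 2) - (j + 2 + i) + t : ℕ) : ℤ) - c * (j + 2 - 2 : ℕ)) =
        ∑ t ∈ Finset.range (i + 1), ((a + b * (n + 1 + j + 2) - c * j) + b * t) := by
      rw [show j + 2 + i + 1 - (j + 2) = i + 1 by omega,
        show j + 2 + i + n + 1 + (j + 2) - (j + 2 + i) = n + 1 + (j + 2) by omega]
      refine Finset.sum_congr rfl fun s _ => ?_
      push_cast
      ring
    have h3 : ∑ t ∈ Finset.range (j + 2 + i + n + 1 - (j + 2 + i)), (a +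
        b * ((j + 2 + i + 1 + t : ℕ) : ℤ) - c * (j + 2 - 1 : ℕ)) =
        ∑ t ∈ Finset.range (n + 1), ((a + b * (j + i + 3) - c * (j + 1)) + b * t) := by
      rw [show j + 2 + i + n + 1 - (j + 2 + i) = n + 1 by omega]
      refine Finset.sum_congr rfl fun s _ => ?_
      push_cast
      ring
    have h4 : ∑ s ∈ Finset.range (j + 2 + i + n + 1 + (j + 2) - 1), (c * ((s : ℤ) + 1)) =
        ∑ s ∈ Finset.range (2 * j + i + n + 4), (c + c * (s : ℤ)) := by
      rw [show j + 2 + i + n + 1 + (j + 2) - 1 = 2 * j + i + n + 4 by omega]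
      refine Finset.sum_congr rfl fun s _ => ?_
      ring
    simp only
    rw [h1, h2, h3, h4]
    simp only [mul_add, two_mul_sum_range_affine]
    push_cast
    ring
  · exact hX.entry_shift _ _ _

theorem IsAffineGraded.fFun_aux (hτ : ∀ t, τ t ≠ 0) (hX : IsAffineGraded σ τ a b c X) {m : ℕ}
    (hm : m ≤ 2 * n - 1) :
    IsSemiInvariant σ τ (fFun X m) (∑ u ∈ Finset.range m,
      (a + b * ((if Even (2 * n - 1 - 1 - u) then n else 1 : ℕ) : ℤ) -
        c * ((2 * n - 1 - 1 - u + 1) / 2 : ℕ) + c * (((2 * n - 1 - 1 - u : ℕ) : ℤ) + 1))) := by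
  rw [← sum_trailing (fun r => a + b * ((if Even r then n else 1 : ℕ) : ℤ) -
        c * ((r + 1) / 2 : ℕ) + c * ((r : ℤ) + 1)) hm]
  exact IsSemiInvariant.det hτ fun r s => hX.entry_shift _ _ _

/-- Enlarging the minor by two adds one copy of row `n` and one of row `1`, both with the same
shift. -/
theorem sum_fFun_even (a b c : ℤ) {m : ℕ} (hm : m < n) :
    ∑ u ∈ Finset.range (2 * m),
      (a + b * ((if Even (2 * n - 1 - 1 - u) then n else 1 : ℕ) : ℤ) -
        c * ((2 * n - 1 - 1 - u + 1) / 2 : ℕ) + c * (((2 * n - 1 - 1 - u : ℕ) : ℤ) + 1)) =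
      2 * m * a + m * (n + 1) * b + m * (2 * n - m) * c := by
  induction m with
  | zero => simp
  | succ m ih =>
    obtain ⟨e, rfl⟩ := Nat.exists_eq_add_of_lt hm
    rw [show 2 * (m + 1) = 2 * m + 1 + 1 by ring, Finset.sum_range_succ, Finset.sum_range_succ,
      ih (by omega), if_pos (by grind), if_neg (by grind),
      show (2 * (m + 1 + e + 1) - 1 - 1 - 2 * m + 1) / 2 = e + 1 by omega,
      show (2 * (m + 1 + e + 1) - 1 - 1 - (2 * m + 1) + 1) / 2 = e + 1 by omega,
      show 2 * (m + 1 + e + 1) - 1 - 1 - 2 * m = 2 * e + 2 by omega,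
      show 2 * (m + 1 + e + 1) - 1 - 1 - (2 * m + 1) = 2 * e + 1 by omega]
    push_cast
    ring

theorem IsAffineGraded.fFun_even (hτ : ∀ t, τ t ≠ 0) (hX : IsAffineGraded σ τ a b c X) {m : ℕ}
    (hm : m < n) :
    IsSemiInvariant σ τ (fFun X (2 * m)) (2 * m * a + m * (n + 1) * b + m * (2 * n - m) * c) := by
  rw [← sum_fFun_even a b c hm]
  exact hX.fFun_aux hτ (by omega)

/-- The term subtracted from the formula for `2 * m` is the weight of the diagonal position of `F`
by which the two minors differ, formally that of `x_{1,n-m}`. -/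
theorem IsAffineGraded.fFun_odd (hτ : ∀ t, τ t ≠ 0) (hX : IsAffineGraded σ τ a b c X) {m : ℕ}
    (hm : 1 ≤ m) (hmn : m ≤ n) :
    IsSemiInvariant σ τ (fFun X (2 * m - 1))
      (2 * m * a + m * (n + 1) * b + m * (2 * n - m) * c - (a + b + c * (n - m))) := by
  obtain ⟨m, rfl⟩ := Nat.exists_eq_add_of_le' hm
  obtain ⟨e, rfl⟩ := Nat.exists_eq_add_of_le hmn
  rw [show 2 * (m + 1) - 1 = 2 * m + 1 by omega]
  have h := hX.fFun_aux hτ (m := 2 * m + 1) (by omega)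
  rw [Finset.sum_range_succ, sum_fFun_even a b c (by omega), if_pos (by grind),
    show (2 * (m + 1 + e) - 1 - 1 - 2 * m + 1) / 2 = e by omega,
    show 2 * (m + 1 + e) - 1 - 1 - 2 * m = 2 * e by omega] at h
  convert h using 1
  push_cast
  ring

/-- The `r`-th row of `Φ_{kl}` contains the row `i - β` of `X` shifted by `s - β` in the `β`-th block
column, where `(i, s)` is the value of this function, if this row of `X` occurs there. -/
def phiRow (n k l r : ℕ) : ℕ × ℕ :=
  let B := min (r / n) (n - k - l - 1)
  let t := r - B * n
  if B + 1 < n - k - l then if t + 1 < n then (2 + t + B, B) else (1 + B, B + 1)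
  else if t < n - l then (l + 1 + t + B, B)
  else if t = n - l then (1 + B, B + 1) else (k + 1 + (t - (n - l)) + B, B + 1)

theorem getD_append_map_range' (p q N M t : ℕ) :
    (((List.range' p N).map fun i => (i, 0)) ++
      (1 :: List.range' q M).map fun i => (i, 1)).getD t ((0 : ℕ), (0 : ℕ)) =
      if t < N then (p + t, 0) else if t = N then (1, 1) else
        if t ≤ N + M then (q + (t - N - 1), 1) else (0, 0) := by
  rw [List.getD_eq_getElem?_getD, List.getElem?_append]
  simp only [List.length_map, List.length_range', List.map_cons, List.getElem?_map,
    List.getElem?_cons]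
  by_cases h1 : t < N
  · simp [h1]
  · by_cases h2 : t = N
    · simp [h2]
    · have h3 : t - N ≠ 0 := by omega
      by_cases h4 : t ≤ N + M
      · have : t - N - 1 < M := by omega
        simp [h1, h2, h3, h4, List.getElem?_range' this]
      · have : (List.range' q M)[t - N - 1]? = none := by
          rw [List.getElem?_eq_none_iff, List.length_range']; omega
        simp [h1, h2, h3, h4, this]

/-- A row of `Φ_{kl}` meets at most two block columns, consecutive ones: it lies in the third tier
of the left one and in the second tier of the right one. Passing to the right lowers both the row
index of `X` and the shift by one, so adding `β` to each gives labels common to the whole row. -/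
theorem phiRows_getD {n k l r β : ℕ} (hk : 1 ≤ k) (hl : 1 ≤ l) (hkl : k + l < n)
    (hβ : β < n - k - l) (hr : β * n ≤ r) :
    (phiRows n k l β).getD (r - β * n) (0, 0) = (0, 0) ∨
      ((phiRows n k l β).getD (r - β * n) (0, 0)).1 + β = (phiRow n k l r).1 ∧
      ((phiRows n k l β).getD (r - β * n) (0, 0)).2 + β = (phiRow n k l r).2 ∧
      ((phiRows n k l β).getD (r - β * n) (0, 0)).2 ≤ 1 := by
  have hn : 0 < n := by omega
  simp only [phiRow]
  set B := min (r / n) (n - k - l - 1) with hB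
  have h1 : β ≤ B := le_min ((Nat.le_div_iff_mul_le hn).mpr hr) (by omega)
  have h2 : B * n ≤ r :=
    (Nat.mul_le_mul_right n (min_le_left _ _)).trans (Nat.div_mul_le_self r n)
  have h3 : B ≤ n - k - l - 1 := min_le_right _ _
  have h4 : B < n - k - l - 1 → r < B * n + n := by
    intro h
    have : B = r / n := by omega
    rw [this]
    have h5 := Nat.div_add_mod r n
    have h6 := Nat.mod_lt r hn
    rw [mul_comm] at h5
    omega
  clear_value B
  obtain ⟨t, rfl⟩ := Nat.exists_eq_add_of_le h2
  rw [Nat.add_sub_cancel_left]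
  unfold phiRows
  simp only
  rw [getD_append_map_range']
  obtain ⟨e, rfl⟩ := Nat.exists_eq_add_of_le h1
  rw [show (β + e) * n + t - β * n = e * n + t by rw [add_mul]; omega]
  -- Here `e` is the distance to the rightmost block column that can meet the row. For `e ≥ 2` the
  -- position lies below the block and `getD` returns its default, a zero entry.
  rcases e with _ | _ | e
  · simp only [zero_mul, zero_add, add_zero] at *
    split_ifs <;> simp only [Prod.mk.injEq, true_and, true_or] <;> omega
  · simp only [zero_add, one_mul] at *
    split_ifs <;> simp only [Prod.mk.injEq, and_self, true_or] <;> omega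
  · left
    have : (e + 1 + 1) * n = e * n + 2 * n := by ring
    rw [this]
    generalize e * n = z
    split_ifs <;> simp only [Prod.mk.injEq, and_self] <;> omega

theorem phiRow_of_lt {k l m s t : ℕ} (hs : s < m) (ht : t < k + l + m + 1) :
    phiRow (k + l + m + 1) k l (s * (k + l + m + 1) + t) =
      if t + 1 < k + l + m + 1 then (2 + t + s, s) else (1 + s, s + 1) := by
  have h1 : (s * (k + l + m + 1) + t) / (k + l + m + 1) = s := by
    rw [mul_comm, Nat.mul_add_div (by omega), Nat.div_eq_of_lt ht, add_zero]
  simp only [phiRow, h1, show k + l + m + 1 - k - l - 1 = m by omega, min_eq_left hs.le,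
    Nat.add_sub_cancel_left, show s + 1 < k + l + m + 1 - k - l by omega, if_true]

theorem phiRow_last (k l m t : ℕ) :
    phiRow (k + l + m + 1) k l (m * (k + l + m + 1) + t) =
      if t < k + m + 1 then (l + 1 + t + m, m)
      else if t = k + m + 1 then (1 + m, m + 1) else (k + 1 + (t - (k + m + 1)) + m, m + 1) := by
  have h1 : min ((m * (k + l + m + 1) + t) / (k + l + m + 1)) m = m :=
    min_eq_right ((Nat.le_div_iff_mul_le (by omega)).mpr (by omega))
  simp only [phiRow, show k + l + m + 1 - k - l - 1 = m by omega, h1,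
    Nat.add_sub_cancel_left, show ¬ m + 1 < k + l + m + 1 - k - l by omega, if_false,
    show k + l + m + 1 - l = k + m + 1 by omega]

theorem sum_phiRow (a b c : ℤ) (k l m : ℕ) :
    2 * ∑ r ∈ Finset.range ((m + 1) * (k + l + m + 1 + 1)),
      (a + b * ((phiRow (k + l + m + 1) k l r).1 : ℤ) - c * (phiRow (k + l + m + 1) k l r).2) =
    2 * (m + 1) * (k + l + m + 2) * a +
      b * (m * (2 * (2 * (k + l + m) + 1) + (k + l + m) * (k + l + m - 1)) +
        (k + l + m + 1) * m * (m - 1) + (k + m + 1) * (2 * (l + m + 1) + k + m) + 2 * (m + 1) +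
        (l + m) * (2 * (k + m + 2) + l + m - 1)) -
      c * (2 * m + (k + l + m + 1) * m * (m - 1) + 2 * (k + m + 1) * m + 2 * (l + m + 1) * (m + 1))
    := by
  -- With `n = k + l + m + 1` there are `m` groups of `n` rows; the last block column adds `n - l`
  -- rows of the second tier, a row `1` and `n - k - 1` further rows.
  rw [show (m + 1) * (k + l + m + 1 + 1) = m * (k + l + m + 1) + (k + m + 1 + ((l + m) + 1)) by ring,
    Finset.sum_range_add, sum_range_mul, Finset.sum_range_add, Finset.sum_range_succ' _ (l + m)]
  have h1 : ∀ s ∈ Finset.range m, ∑ t ∈ Finset.range (k + l + m + 1), (a +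
      b * ((phiRow (k + l + m + 1) k l (s * (k + l + m + 1) + t)).1 : ℤ) -
      c * (phiRow (k + l + m + 1) k l (s * (k + l + m + 1) + t)).2) =
      (∑ t ∈ Finset.range (k + l + m), ((a + 2 * b) + b * (t : ℤ)) + a + b - c) +
        (b - c) * (k + l + m + 1) * s := by
    intro s hs
    rw [Finset.sum_range_succ]
    have : ∀ t ∈ Finset.range (k + l + m), (a +
      b * ((phiRow (k + l + m + 1) k l (s * (k + l + m + 1) + t)).1 : ℤ) -
      c * (phiRow (k + l + m + 1) k l (s * (k + l + m + 1) + t)).2) =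
      ((a + 2 * b) + b * (t : ℤ)) + (b - c) * s := by
      intro t ht
      have := Finset.mem_range.mp ht
      rw [phiRow_of_lt (Finset.mem_range.mp hs) (by omega), if_pos (by omega)]
      push_cast
      ring
    rw [Finset.sum_congr rfl this, phiRow_of_lt (Finset.mem_range.mp hs) (by omega),
      if_neg (by omega), Finset.sum_add_distrib]
    simp
    ring
  have h2 : ∀ t ∈ Finset.range (k + m + 1), (a +
      b * ((phiRow (k + l + m + 1) k l (m * (k + l + m + 1) + t)).1 : ℤ) -
      c * (phiRow (k + l + m + 1) k l (m * (k + l + m + 1) + t)).2) =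
      (a + b * (l + 1 + m) - c * m) + b * t := by
    intro t ht
    rw [phiRow_last, if_pos (Finset.mem_range.mp ht)]
    push_cast
    ring
  have h3 : ∀ t ∈ Finset.range (l + m), (a +
      b * ((phiRow (k + l + m + 1) k l (m * (k + l + m + 1) + (k + m + 1 + (t + 1)))).1 : ℤ) -
      c * (phiRow (k + l + m + 1) k l (m * (k + l + m + 1) + (k + m + 1 + (t + 1)))).2) =
      (a + b * (k + 2 + m) - c * (m + 1)) + b * t := by
    intro t ht
    rw [phiRow_last, if_neg (by omega), if_neg (by omega), Nat.add_sub_cancel_left]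
    push_cast
    ring
  rw [Finset.sum_congr rfl h1, Finset.sum_congr rfl h2, Finset.sum_congr rfl h3, phiRow_last,
    if_neg (by omega), if_pos (by omega), mul_add 2 (Finset.sum _ _), two_mul_sum_range_affine]
  have h4 := two_mul_sum_range_affine (a + 2 * b) b (k + l + m)
  have h5 := two_mul_sum_range_affine (a + b * (l + 1 + m) - c * m) b (k + m + 1)
  have h6 := two_mul_sum_range_affine (a + b * (k + 2 + m) - c * (m + 1)) b (l + m)
  push_cast at h4 h5 h6 ⊢
  linear_combination (m : ℤ) * h4 + h5 + h6

/-- Moving one block column to the right changes the weight of every row's part by the same `c - b`,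
as index and shift both drop by one. This constant goes into the column weight, and the determinant
is homogeneous despite the overlapping blocks. -/
theorem IsAffineGraded.phiFun (hτ : ∀ t, τ t ≠ 0) (hX : IsAffineGraded σ τ a b c X) {k l : ℕ}
    (hk : 1 ≤ k) (hl : 1 ≤ l) (hkl : k + l < n) :
    ∃ d : ℤ, (∀ m : ℤ, m = n - k - l → 2 * d = 2 * m * (n + 1) * a +
      b * ((m - 1) * (2 * (2 * n - 1) + (n - 1) * (n - 2)) + n * (m - 1) * (m - 2) +
        (n - l) * (2 * (l + m) + n - l - 1) + 2 * m + (n - k - 1) * (2 * (k + m + 1) + n - k - 2) -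
        (n + 1) * m * (m - 1)) +
      c * (m * (n + 1) * (n + 2) + (n + 1) * m * (m - 1) - (2 * (m - 1) + n * (m - 1) * (m - 2) +
        2 * (n - l) * (m - 1) + 2 * (n - k) * m))) ∧
      IsSemiInvariant σ τ (phiFun X k l) d := by
  refine ⟨_, ?_, IsSemiInvariant.det hτ
    (ρ := fun r : Fin ((n - k - l) * (n + 1)) =>
      a + b * ((phiRow n k l r).1 : ℤ) - c * (phiRow n k l r).2)
    (κ := fun s : Fin ((n - k - l) * (n + 1)) =>
      c * (((s % (n + 1) : ℕ) : ℤ) + 1) + (c - b) * (s / (n + 1) : ℕ)) fun r s => ?_⟩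
  · rintro m rfl
    rw [Finset.sum_add_distrib,
      ← Finset.sum_range (fun r => a + b * ((phiRow n k l r).1 : ℤ) - c * (phiRow n k l r).2),
      ← Finset.sum_range (fun s => c * (((s % (n + 1) : ℕ) : ℤ) + 1) + (c - b) * (s / (n + 1) : ℕ))]
    obtain ⟨m, rfl⟩ := Nat.exists_eq_add_of_lt hkl
    rw [show k + l + m + 1 - k - l = m + 1 by omega, mul_add, sum_phiRow, sum_range_mul]
    have h1 : ∀ s ∈ Finset.range (m + 1), ∑ t ∈ Finset.range (k + l + m + 1 + 1),
        (c * ((((s * (k + l + m + 1 + 1) + t) % (k + l + m + 1 + 1) : ℕ) : ℤ) + 1) +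
          (c - b) * ((s * (k + l + m + 1 + 1) + t) / (k + l + m + 1 + 1) : ℕ)) =
        ∑ t ∈ Finset.range (k + l + m + 1 + 1), (c + c * (t : ℤ)) +
          ((c - b) * (k + l + m + 2)) * s := by
      intro s _
      have : ∀ t ∈ Finset.range (k + l + m + 1 + 1),
          (c * ((((s * (k + l + m + 1 + 1) + t) % (k + l + m + 1 + 1) : ℕ) : ℤ) + 1) +
          (c - b) * ((s * (k + l + m + 1 + 1) + t) / (k + l + m + 1 + 1) : ℕ)) =
          (c + c * (t : ℤ)) + (c - b) * s := by
        intro t ht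
        have ht := Finset.mem_range.mp ht
        rw [mul_comm s, Nat.mul_add_mod, Nat.mod_eq_of_lt ht, Nat.mul_add_div (by omega),
          Nat.div_eq_of_lt ht]
        push_cast
        ring
      rw [Finset.sum_congr rfl this, Finset.sum_add_distrib, Finset.sum_const, Finset.card_range]
      ring
    rw [Finset.sum_congr rfl h1, two_mul_sum_range_affine]
    have h2 := two_mul_sum_range_affine c c (k + l + m + 1 + 1)
    push_cast at h2 ⊢
    linear_combination ((m : ℤ) + 1) * h2
  · simp only [phiMatrix, Matrix.of_apply]
    split_ifs with h
    · have hs : (s : ℕ) / (n + 1) < n - k - l :=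
        Nat.div_lt_of_lt_mul (s.2.trans_eq (mul_comm _ _))
      rcases phiRows_getD hk hl hkl hs h with h' | ⟨h1, h2, -⟩
      · rw [h', entry_zero_left]
        exact .zero _
      · convert hX.entry_shift _ _ _ using 1
        rw [← h1, ← h2]
        push_cast
        ring
    · exact .zero _

end Degrees

/-- Twice the degree of the variable of the initial extended cluster attached to a vertex, if the
degree of `x_{ij}` is `a + b i + c j`. -/
def twiceDegree (n a b c : ℤ) : Vertex → ℤ
  | .phi k l => 2 * (n - k - l) * (n + 1) * a +
      b * ((n - k - l - 1) * (2 * (2 * n - 1) + (n - 1) * (n - 2)) +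
        n * (n - k - l - 1) * (n - k - l - 2) + (n - l) * (2 * (l + (n - k - l)) + n - l - 1) +
        2 * (n - k - l) + (n - k - 1) * (2 * (k + (n - k - l) + 1) + n - k - 2) -
        (n + 1) * (n - k - l) * (n - k - l - 1)) +
      c * ((n - k - l) * (n + 1) * (n + 2) + (n + 1) * (n - k - l) * (n - k - l - 1) -
        (2 * (n - k - l - 1) + n * (n - k - l - 1) * (n - k - l - 2) +
        2 * (n - l) * (n - k - l - 1) + 2 * (n - k) * (n - k - l)))
  | .g i j => 2 * a * (n + j - 1) +
      b * (2 * (j - 2) * (n + 1) + 4 + (i + 1 - j) * (2 * n + j - i) + (n - i) * (n + i + 1)) +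
      c * ((n + j - 1) * (n + j) -
        2 * ((j - 2) * (j - 3) + (j - 2) * (i + 2 - j) + (j - 1) * (n - i + 1)))
  | .plus m => 2 * (2 * m * a + m * (n + 1) * b + m * (2 * n - m) * c)
  | .minus m => 2 * (2 * m * a + m * (n + 1) * b + m * (2 * n - m) * c - (a + b + c * (n - m)))
  | .A => 2 * (a + b + n * c)
  | .B => 2 * n * a + (b + c) * n * (n + 1)
  | .C => 2 * (a + n * b + c)
  | .c r => 2 * (n + 1) * a + b * (n * (n + 1) + 2 + 2 * r) + c * (n * (n + 1) + 2 * n - 2 * r)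

/-! ### Vertices and arrows of `Q_n` -/

theorem phi_mem {n k l : ℕ} : Vertex.phi k l ∈ mutableVertices n ↔ 1 ≤ k ∧ 1 ≤ l ∧ k + l ≤ n - 1 := by
  simp only [mutableVertices, Finset.mem_union, Finset.mem_image, Finset.mem_filter,
    Finset.mem_product, Finset.mem_Icc, Prod.exists, Vertex.phi.injEq, reduceCtorEq, and_false,
    exists_false, or_false, exists_eq_right_right, exists_eq_right]
  omega

theorem g_mem {n i j : ℕ} : Vertex.g i j ∈ mutableVertices n ↔ 2 ≤ j ∧ j ≤ i ∧ i ≤ n - 1 := by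
  simp only [mutableVertices, Finset.mem_union, Finset.mem_image, Finset.mem_filter,
    Finset.mem_product, Finset.mem_Icc, Prod.exists, Vertex.g.injEq, reduceCtorEq, and_false,
    exists_false, or_false, false_or, exists_eq_right_right, exists_eq_right]
  omega

theorem plus_mem {n m : ℕ} : Vertex.plus m ∈ mutableVertices n ↔ 1 ≤ m ∧ m ≤ n - 2 := by
  simp [mutableVertices]

theorem minus_mem {n m : ℕ} : Vertex.minus m ∈ mutableVertices n ↔ 1 ≤ m ∧ m ≤ n - 1 := by
  simp [mutableVertices]

theorem A_notMem {n : ℕ} : Vertex.A ∉ mutableVertices n := by simp [mutableVertices]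

theorem B_notMem {n : ℕ} : Vertex.B ∉ mutableVertices n := by simp [mutableVertices]

theorem C_notMem {n : ℕ} : Vertex.C ∉ mutableVertices n := by simp [mutableVertices]

theorem c_notMem {n r : ℕ} : Vertex.c r ∉ mutableVertices n := by simp [mutableVertices]

theorem sum_frozenVertex {n : ℕ} (f : Vertex → ℤ) :
    ∑ w : FrozenVertex n, f w.1 =
      f .A + f .B + f .C + ∑ r ∈ Finset.Icc 1 (n - 2), f (.c r) := by
  rw [Finset.sum_coe_sort (frozenVertices n) f, frozenVertices,
    Finset.sum_union (by simp [Finset.disjoint_left]), Finset.sum_image (by simp)]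
  simp [add_assoc]

/-- A sum over the mutable vertices whose weights are supported on a list of vertices. -/
theorem sum_mutableVertex_of_list {n : ℕ} {D : Vertex → ℤ} {N : Vertex → ℕ}
    {L : List (ℕ × Vertex)} (hL : ∀ p ∈ L, p.1 ≠ 0 → p.2 ∈ mutableVertices n)
    (hN : ∀ w ∈ mutableVertices n, N w = (L.map fun p => if w = p.2 then p.1 else 0).sum) :
    ∑ w : MutableVertex n, (N w.1 : ℤ) * D w.1 = (L.map fun p => (p.1 : ℤ) * D p.2).sum := by
  rw [Finset.sum_coe_sort (mutableVertices n) fun w => (N w : ℤ) * D w,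
    Finset.sum_congr rfl fun w hw => by rw [hN w hw]]
  clear hN
  induction L with
  | nil => simp
  | cons p L ih =>
    simp only [List.map_cons, List.sum_cons, Nat.cast_add, add_mul, Finset.sum_add_distrib]
    rw [ih fun q hq => hL q (List.mem_cons_of_mem _ hq)]
    congr 1
    by_cases hp : p.1 = 0
    · simp [hp]
    · simp [hL p List.mem_cons_self hp]

theorem phi_mem_union {n k l : ℕ} (h : Vertex.phi k l ∈ mutableVertices n ∪ frozenVertices n) :
    1 ≤ k ∧ 1 ≤ l ∧ k + l ≤ n - 1 := by
  rw [Finset.mem_union, phi_mem] at h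
  simpa [frozenVertices] using h

theorem g_mem_union {n i j : ℕ} (h : Vertex.g i j ∈ mutableVertices n ∪ frozenVertices n) :
    2 ≤ j ∧ j ≤ i ∧ i ≤ n - 1 := by
  rw [Finset.mem_union, g_mem] at h
  simpa [frozenVertices] using h

theorem quiverArrows_no_two_cycles {n : ℕ} (hn : 4 ≤ n) {v w : Vertex}
    (hv : v ∈ mutableVertices n ∪ frozenVertices n)
    (hw : w ∈ mutableVertices n ∪ frozenVertices n) :
    quiverArrows n v w = 0 ∨ quiverArrows n w v = 0 := by
  cases v <;> cases w <;>
    simp only [quiverArrows, Nat.add_eq_zero_iff, ite_eq_right_iff, one_ne_zero, imp_false,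
      OfNat.ofNat_ne_zero, true_or, or_true]
  case phi.phi => have := phi_mem_union hv; have := phi_mem_union hw; omega
  case g.g => have := g_mem_union hv; have := g_mem_union hw; omega
  all_goals omega

/-- The mutable vertices at the heads of the arrows from a mutable vertex. -/
def mutableOut (n : ℕ) : Vertex → List (ℕ × Vertex)
  | .phi k l =>
    [(if 2 ≤ k then 1 else 0, .phi (k - 1) (l + 1)),
      (if l ≠ 1 ∧ k + l + 1 ≤ n - 1 then 1 else 0, .phi (k + 1) l),
      (if 2 ≤ l then 1 else 0, .phi k (l - 1)),
      (if k = 1 ∧ l + 2 ≤ n - 1 then 1 else 0, .phi (l + 1) 1),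
      (if 2 ≤ k ∧ l = 1 then 1 else 0, .phi 1 k),
      (if k + l = n - 1 ∧ k + 2 ≤ n - 1 then 1 else 0, .g (k + 2) 2)]
  | .g i j =>
    [(if j + 1 ≤ i then 1 else 0, .g (i - 1) j),
      (if i ≠ j ∧ i + 1 ≤ n - 1 then 1 else 0, .g (i + 1) (j + 1)),
      (if 3 ≤ j then 1 else 0, .g i (j - 1)),
      (if i = n - 1 ∧ j ≤ n - 2 then 1 else 0, .g j j),
      (if i = j ∧ j + 1 ≤ n - 1 then 1 else 0, .g (n - 1) (j + 1)),
      (if j = 2 then 1 else 0, .phi (i - 1) (n - i)),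
      (if i = n - 1 ∧ j = n - 1 then 1 else 0, .plus (n - 2))]
  | .plus m => [(if 2 ≤ m then 1 else 0, .plus (m - 1)), (2, .minus (m + 1))]
  | .minus m =>
    [(if 2 ≤ m then 1 else 0, .minus (m - 1)), (if m ≤ n - 2 then 2 else 0, .plus m),
      (if m = n - 1 then 1 else 0, .g (n - 1) (n - 1))]
  | _ => []

/-- The mutable vertices at the tails of the arrows to a mutable vertex. -/
def mutableIn (n : ℕ) : Vertex → List (ℕ × Vertex)
  | .phi k l =>
    [(if 2 ≤ l then 1 else 0, .phi (k + 1) (l - 1)),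
      (if 2 ≤ k ∧ l ≠ 1 then 1 else 0, .phi (k - 1) l),
      (if k + l + 1 ≤ n - 1 then 1 else 0, .phi k (l + 1)),
      (if 2 ≤ k ∧ l = 1 then 1 else 0, .phi 1 (k - 1)),
      (if k = 1 ∧ 2 ≤ l then 1 else 0, .phi l 1),
      (if k + l = n - 1 then 1 else 0, .g (k + 1) 2)]
  | .g i j =>
    [(if i + 1 ≤ n - 1 then 1 else 0, .g (i + 1) j),
      (if i ≠ j ∧ 3 ≤ j then 1 else 0, .g (i - 1) (j - 1)),
      (if j + 1 ≤ i then 1 else 0, .g i (j + 1)),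
      (if i = j ∧ j ≤ n - 2 then 1 else 0, .g (n - 1) j),
      (if i = n - 1 ∧ 3 ≤ j then 1 else 0, .g (j - 1) (j - 1)),
      (if j = 2 ∧ 3 ≤ i then 1 else 0, .phi (i - 2) (n + 1 - i)),
      (if i = n - 1 ∧ j = n - 1 then 1 else 0, .minus (n - 1))]
  | .plus m =>
    [(if m + 1 ≤ n - 2 then 1 else 0, .plus (m + 1)), (2, .minus m),
      (if m = n - 2 then 1 else 0, .g (n - 1) (n - 1))]
  | .minus m =>
    [(if m + 1 ≤ n - 1 then 1 else 0, .minus (m + 1)), (if 2 ≤ m then 2 else 0, .plus (m - 1))]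
  | _ => []

theorem add_eq_add {x y z w : ℕ} (h : x = y) (h' : z = w) : x + z = y + w := by rw [h, h']

/-- The guards in the lists give multiplicity zero to arrows whose other end does not exist, so only
entries with nonzero multiplicity have to be mutable. -/
theorem mutableOut_mem {n : ℕ} (hn : 4 ≤ n) {v : Vertex} (hv : v ∈ mutableVertices n) :
    ∀ p ∈ mutableOut n v, p.1 ≠ 0 → p.2 ∈ mutableVertices n := by
  cases v <;>
    simp only [phi_mem, g_mem, plus_mem, minus_mem, A_notMem, B_notMem, C_notMem, c_notMem] at hv <;>
    simp only [mutableOut, List.forall_mem_cons, phi_mem, g_mem, plus_mem, minus_mem, ne_eq,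
      ite_eq_right_iff, one_ne_zero, imp_false, not_not, OfNat.ofNat_ne_zero, not_false_eq_true,
      forall_const, List.not_mem_nil, false_imp_iff, implies_true, and_true] <;> omega

theorem mutableIn_mem {n : ℕ} (hn : 4 ≤ n) {v : Vertex} (hv : v ∈ mutableVertices n) :
    ∀ p ∈ mutableIn n v, p.1 ≠ 0 → p.2 ∈ mutableVertices n := by
  cases v <;>
    simp only [phi_mem, g_mem, plus_mem, minus_mem, A_notMem, B_notMem, C_notMem, c_notMem] at hv <;>
    simp only [mutableIn, List.forall_mem_cons, phi_mem, g_mem, plus_mem, minus_mem, ne_eq,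
      ite_eq_right_iff, one_ne_zero, imp_false, not_not, OfNat.ofNat_ne_zero, not_false_eq_true,
      forall_const, List.not_mem_nil, false_imp_iff, implies_true, and_true] <;> omega

theorem quiverArrows_eq_mutableOut {n : ℕ} (hn : 4 ≤ n) {v w : Vertex}
    (hv : v ∈ mutableVertices n) (hw : w ∈ mutableVertices n) :
    quiverArrows n v w = ((mutableOut n v).map fun p => if w = p.2 then p.1 else 0).sum := by
  cases v <;>
    simp only [phi_mem, g_mem, plus_mem, minus_mem, A_notMem, B_notMem, C_notMem, c_notMem] at hv <;>
  cases w <;>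
    simp only [phi_mem, g_mem, plus_mem, minus_mem, A_notMem, B_notMem, C_notMem, c_notMem] at hw <;>
    simp only [quiverArrows, mutableOut, List.map_cons, List.map_nil, List.sum_cons, List.sum_nil,
      Vertex.phi.injEq, Vertex.g.injEq, Vertex.plus.injEq, Vertex.minus.injEq, reduceCtorEq,
      if_false, add_zero, zero_add, ← add_assoc] <;>
    -- The list follows the order of the summands of `quiverArrows`, so arrow types are compared one
    -- by one.
    repeat' apply add_eq_add
  all_goals split_ifs <;> omega

theorem quiverArrows_eq_mutableIn {n : ℕ} (hn : 4 ≤ n) {v w : Vertex}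
    (hv : v ∈ mutableVertices n) (hw : w ∈ mutableVertices n) :
    quiverArrows n w v = ((mutableIn n v).map fun p => if w = p.2 then p.1 else 0).sum := by
  cases v <;>
    simp only [phi_mem, g_mem, plus_mem, minus_mem, A_notMem, B_notMem, C_notMem, c_notMem] at hv <;>
  cases w <;>
    simp only [phi_mem, g_mem, plus_mem, minus_mem, A_notMem, B_notMem, C_notMem, c_notMem] at hw <;>
    simp only [quiverArrows, mutableIn, List.map_cons, List.map_nil, List.sum_cons, List.sum_nil,
      Vertex.phi.injEq, Vertex.g.injEq, Vertex.plus.injEq, Vertex.minus.injEq, reduceCtorEq,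
      if_false, add_zero, zero_add, ← add_assoc] <;>
    repeat' apply add_eq_add
  all_goals split_ifs <;> omega

/-- The weighted sum of the mutable neighbours of a mutable vertex. -/
def mutableBalance (n : ℕ) (D : Vertex → ℤ) (v : Vertex) : ℤ :=
  ((mutableOut n v).map fun p => (p.1 : ℤ) * D p.2).sum -
    ((mutableIn n v).map fun p => (p.1 : ℤ) * D p.2).sum

theorem sum_mutable_net {n : ℕ} (hn : 4 ≤ n) {v : Vertex} (hv : v ∈ mutableVertices n)
    (D : Vertex → ℤ) :
    ∑ w : MutableVertex n, ((quiverArrows n v w.1 : ℤ) - quiverArrows n w.1 v) * D w.1 =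
      mutableBalance n D v := by
  simp only [sub_mul, Finset.sum_sub_distrib]
  rw [sum_mutableVertex_of_list (mutableOut_mem hn hv) fun w => quiverArrows_eq_mutableOut hn hv,
    sum_mutableVertex_of_list (N := fun w => quiverArrows n w v) (mutableIn_mem hn hv)
      fun w => quiverArrows_eq_mutableIn hn hv]
  rfl

/-- The weighted sum of the frozen neighbours of a mutable vertex. -/
def frozenBalance (n : ℕ) (D : Vertex → ℤ) (v : Vertex) : ℤ :=
  ((quiverArrows n v .A : ℤ) - quiverArrows n .A v) * D .A +
    ((quiverArrows n v .B : ℤ) - quiverArrows n .B v) * D .B +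
    ((quiverArrows n v .C : ℤ) - quiverArrows n .C v) * D .C

theorem sum_frozen_net {n : ℕ} (v : Vertex) (D : Vertex → ℤ) :
    ∑ w : FrozenVertex n, ((quiverArrows n v w.1 : ℤ) - quiverArrows n w.1 v) * D w.1 =
      frozenBalance n D v := by
  rw [sum_frozenVertex fun w => ((quiverArrows n v w : ℤ) - quiverArrows n w v) * D w,
    Finset.sum_eq_zero, add_zero, frozenBalance]
  intro r _
  cases v <;> simp [quiverArrows]

/-! ### Homogeneity of the exchange relations of the initial seed -/

section Balance

variable {n : ℕ} (a b c : ℤ)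

/-- The mutable part alone is not balanced here; `r` times this defect must be compensated by `A`,
`C` and the string. -/
theorem mutableBalance_phi_one_one (hn : 4 ≤ n) :
    mutableBalance n (twiceDegree n a b c) (.phi 1 1) = 2 * (c - b) := by
  obtain ⟨k, hk⟩ : ∃ k, k = 1 := ⟨1, rfl⟩
  rw [← hk]
  simp only [mutableBalance, mutableOut, mutableIn, List.map_cons, List.map_nil, List.sum_cons,
    List.sum_nil]
  repeat first | rw [if_pos (by omega)] | rw [if_neg (by omega)]
  simp only [twiceDegree, hk]
  push_cast
  ring

theorem balance_phi {k l : ℕ} (hn : 4 ≤ n) (hk : 1 ≤ k) (hl : 1 ≤ l) (hkl : k + l < n)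
    (h : ¬ (k = 1 ∧ l = 1)) :
    mutableBalance n (twiceDegree n a b c) (.phi k l) +
      frozenBalance n (twiceDegree n a b c) (.phi k l) = 0 := by
  have hk' : ((k - 1 : ℕ) : ℤ) = k - 1 := by omega
  have hl' : ((l - 1 : ℕ) : ℤ) = l - 1 := by omega
  simp only [mutableBalance, mutableOut, mutableIn, List.map_cons, List.map_nil, List.sum_cons,
    List.sum_nil, frozenBalance, quiverArrows]
  -- The three splits record which sides of the triangle contain the vertex. On each stratum all
  -- guards are constant, leaving a polynomial identity.
  rcases eq_or_ne k 1 with hk1 | hk1 <;> rcases eq_or_ne l 1 with hl1 | hl1 <;>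
    rcases eq_or_ne n (k + l + 1) with hn1 | hn1
  all_goals
    try omega
  all_goals
    repeat first | rw [if_pos (by omega)] | rw [if_neg (by omega)]
    simp only [twiceDegree, Nat.cast_add, Nat.cast_one, Nat.cast_zero, Nat.cast_ofNat, hk', hl']
    try rw [hn1]
    try rw [hk1]
    try rw [hl1]
    push_cast
    ring

theorem balance_g {i j : ℕ} (hn : 4 ≤ n) (hj : 2 ≤ j) (hij : j ≤ i) (hi : i < n) :
    mutableBalance n (twiceDegree n a b c) (.g i j) +
      frozenBalance n (twiceDegree n a b c) (.g i j) = 0 := by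
  have hj' : ((j - 1 : ℕ) : ℤ) = j - 1 := by omega
  have hi' : ((i - 1 : ℕ) : ℤ) = i - 1 := by omega
  have hi2 : ((i - 2 : ℕ) : ℤ) = i - 2 := by omega
  have hn' : ((n - 1 : ℕ) : ℤ) = n - 1 := by omega
  have hn2 : ((n - 2 : ℕ) : ℤ) = n - 2 := by omega
  have hni : ((n - i : ℕ) : ℤ) = n - i := by omega
  have hni' : ((n + 1 - i : ℕ) : ℤ) = n + 1 - i := by omega
  simp only [mutableBalance, mutableOut, mutableIn, List.map_cons, List.map_nil, List.sum_cons,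
    List.sum_nil, frozenBalance, quiverArrows]
  -- Again the strata are the sides `j = 2`, `i = j` and `i = n - 1` of the triangle and their
  -- intersections.
  rcases eq_or_ne j 2 with hj1 | hj1 <;> rcases eq_or_ne i j with hij1 | hij1 <;>
    rcases eq_or_ne n (i + 1) with hn1 | hn1
  all_goals
    try omega
  all_goals
    repeat first | rw [if_pos (by omega)] | rw [if_neg (by omega)]
    simp only [twiceDegree, Nat.cast_add, Nat.cast_one, Nat.cast_zero, hj', hi', hi2,
      hn', hn2, hni, hni']
    try rw [hn1]
    try rw [hij1]
    try rw [hj1]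
    push_cast
    ring

/-- The degree of `(m,+)` is quadratic in `m` and vanishes at `m = 0`, which accounts for the
missing neighbour of `(1,+)`. At `m = n - 2` the vertex `D`, graded by the formula for `g`, takes
the place of `(n-1,+)`. -/
theorem balance_plus {m : ℕ} (hm : 1 ≤ m) (hmn : m ≤ n - 2) :
    mutableBalance n (twiceDegree n a b c) (.plus m) +
      frozenBalance n (twiceDegree n a b c) (.plus m) = 0 := by
  have hm' : ((m - 1 : ℕ) : ℤ) = m - 1 := by omega
  have hn' : ((n - 1 : ℕ) : ℤ) = n - 1 := by omega
  simp only [mutableBalance, mutableOut, mutableIn, List.map_cons, List.map_nil, List.sum_cons,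
    List.sum_nil, frozenBalance, quiverArrows]
  rcases eq_or_ne m 1 with hm1 | hm1 <;> rcases eq_or_ne n (m + 2) with hn1 | hn1
  all_goals
    repeat first | rw [if_pos (by omega)] | rw [if_neg (by omega)]
    simp only [twiceDegree, Nat.cast_add, Nat.cast_one, Nat.cast_zero, Nat.cast_ofNat, hm', hn']
    try rw [hn1]
    try rw [hm1]
    push_cast
    ring

/-- Extrapolated to `m = 0`, the degree of `(m,-)` is minus that of `A`, matching the arrow from
`A`. Extrapolated to `m = n` it is the sum of the degrees of `C` and `D`, matching the arrows at
`(n-1,-)`. -/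
theorem balance_minus {m : ℕ} (hm : 1 ≤ m) (hmn : m < n) :
    mutableBalance n (twiceDegree n a b c) (.minus m) +
      frozenBalance n (twiceDegree n a b c) (.minus m) = 0 := by
  have hm' : ((m - 1 : ℕ) : ℤ) = m - 1 := by omega
  have hn' : ((n - 1 : ℕ) : ℤ) = n - 1 := by omega
  simp only [mutableBalance, mutableOut, mutableIn, List.map_cons, List.map_nil, List.sum_cons,
    List.sum_nil, frozenBalance, quiverArrows]
  rcases eq_or_ne m 1 with hm1 | hm1 <;> rcases eq_or_ne n (m + 1) with hn1 | hn1
  all_goals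
    repeat first | rw [if_pos (by omega)] | rw [if_neg (by omega)]
    simp only [twiceDegree, Nat.cast_add, Nat.cast_one, Nat.cast_zero, Nat.cast_ofNat, hm', hn']
    try rw [hn1]
    try rw [hm1]
    push_cast
    ring

end Balance

variable {n : ℕ}

/-! ### Grading of the initial seed -/

section InitialSeed

variable {T : Type*} {σ : T → RatFun n →+* RatFun n} {τ : T → RatFun n} {a b c : ℤ}

theorem initialVar_isSemiInvariant (hn : 4 ≤ n) (hτ : ∀ t, τ t ≠ 0)
    (hX : IsAffineGraded σ τ a b c (genericMatrix n)) {v : Vertex}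
    (hv : v ∈ mutableVertices n ∪ frozenVertices n) :
    ∃ d, 2 * d = twiceDegree n a b c v ∧ IsSemiInvariant σ τ (initialVar n v) d := by
  cases v with
  | phi k l =>
    obtain ⟨hk, hl, hkl⟩ := phi_mem_union hv
    obtain ⟨d, hd, h⟩ := hX.phiFun hτ hk hl (by omega)
    exact ⟨d, hd _ rfl, h⟩
  | g i j =>
    obtain ⟨hj, hij, hi⟩ := g_mem_union hv
    exact hX.gFun hτ hj hij (by omega)
  | plus m =>
    have hm : 1 ≤ m ∧ m ≤ n - 2 := by
      rw [Finset.mem_union, plus_mem] at hv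
      simpa [frozenVertices] using hv
    exact ⟨_, rfl, hX.fFun_even hτ (by omega)⟩
  | minus m =>
    have hm : 1 ≤ m ∧ m ≤ n - 1 := by
      rw [Finset.mem_union, minus_mem] at hv
      simpa [frozenVertices] using hv
    exact ⟨_, rfl, hX.fFun_odd hτ hm.1 (by omega)⟩
  | A =>
    refine ⟨_, ?_, hX.entry 1 n⟩
    simp only [twiceDegree]
    push_cast
    ring
  | B => exact hX.det hτ
  | C =>
    refine ⟨_, ?_, hX.entry n 1⟩
    simp only [twiceDegree]
    push_cast
    ring
  | c r => exact hX.cFun hτ r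

theorem toVertex_mem (v : MutableVertex n ⊕ FrozenVertex n) :
    toVertex v ∈ mutableVertices n ∪ frozenVertices n := by
  rcases v with v | v
  · exact Finset.mem_union_left _ v.2
  · exact Finset.mem_union_right _ v.2

theorem balance_of_ne (hn : 4 ≤ n) {v : Vertex} (hv : v ∈ mutableVertices n)
    (h : v ≠ .phi 1 1) :
    mutableBalance n (twiceDegree n a b c) v + frozenBalance n (twiceDegree n a b c) v = 0 := by
  cases v with
  | phi k l =>
    obtain ⟨hk, hl, hkl⟩ := phi_mem.mp hv
    exact balance_phi a b c hn hk hl (by omega) fun h' => h (by rw [h'.1, h'.2])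
  | g i j =>
    obtain ⟨hj, hij, hi⟩ := g_mem.mp hv
    exact balance_g a b c hn hj hij (by omega)
  | plus m => exact balance_plus a b c (plus_mem.mp hv).1 (plus_mem.mp hv).2
  | minus m =>
    have := minus_mem.mp hv
    exact balance_minus a b c this.1 (by omega)
  | A => exact absurd hv A_notMem
  | B => exact absurd hv B_notMem
  | C => exact absurd hv C_notMem
  | c r => exact absurd hv c_notMem

/-- For `0 < r < n - 1` the floors are `-1` for the incoming `A` and `0` for the outgoing `C`, and
the degree of `c_r / det X` exceeds that of `A` by `r * (b - c)`. For `r = n - 1` the string is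
trivial and `C / A` supplies the same compensation. -/
theorem balance_phi_one_one (hn : 4 ≤ n) {r : ℕ} (hr : r ≤ n - 1) :
    ∑ w : FrozenVertex n, initialCoeff n (.phi 1 1) r w.1 * twiceDegree n a b c w.1 +
      r * (2 * (c - b)) +
      ∑ w : FrozenVertex n, (r * ((quiverArrows n (.phi 1 1) w.1 : ℤ) -
        quiverArrows n w.1 (.phi 1 1))) / ((n - 1 : ℕ) : ℤ) * twiceDegree n a b c w.1 = 0 := by
  have hn' : ((n - 1 : ℕ) : ℤ) = n - 1 := by omega
  have hpos : (0 : ℤ) < ((n - 1 : ℕ) : ℤ) := by omega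
  have hfloor : ∑ w : FrozenVertex n, (r * ((quiverArrows n (.phi 1 1) w.1 : ℤ) -
        quiverArrows n w.1 (.phi 1 1))) / ((n - 1 : ℕ) : ℤ) * twiceDegree n a b c w.1 =
      (-(r : ℤ)) / ((n - 1 : ℕ) : ℤ) * twiceDegree n a b c .A +
        (r : ℤ) / ((n - 1 : ℕ) : ℤ) * twiceDegree n a b c .C := by
    rw [sum_frozenVertex fun w => (r * ((quiverArrows n (.phi 1 1) w : ℤ) -
        quiverArrows n w (.phi 1 1))) / ((n - 1 : ℕ) : ℤ) * twiceDegree n a b c w,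
      Finset.sum_eq_zero (by intros; simp [quiverArrows])]
    simp only [quiverArrows, and_true, if_true]
    rw [if_neg (by omega)]
    simp
  rw [hfloor, sum_frozenVertex fun w => initialCoeff n (.phi 1 1) r w * twiceDegree n a b c w]
  have hr' : r = 0 ∨ r = n - 1 ∨ (1 ≤ r ∧ r ≤ n - 2) := by omega
  rcases hr' with rfl | rfl | ⟨h1, h2⟩
  · simp [initialCoeff]
  · have h3 : ¬ (n - 1 ≤ n - 2) := by omega
    rw [Int.neg_ediv_self _ hpos.ne', Int.ediv_self hpos.ne']
    simp only [initialCoeff, h3, and_false, if_false, zero_mul, Finset.sum_const_zero, twiceDegree,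
      hn']
    ring
  · have hfloor_pos : (r : ℤ) / ((n - 1 : ℕ) : ℤ) = 0 :=
      Int.ediv_eq_zero_of_lt (by omega) (by omega)
    have hfloor_neg : (-(r : ℤ)) / ((n - 1 : ℕ) : ℤ) = -1 :=
      (Int.ediv_eq_iff_of_pos hpos).mpr (by omega)
    rw [hfloor_pos, hfloor_neg]
    have h3 : ∀ s : ℕ, ((if s = r then 1 else 0 : ℤ)) * twiceDegree n a b c (.c s) =
        if s = r then twiceDegree n a b c (.c r) else 0 := by
      intro s
      split_ifs with h
      · rw [h, one_mul]
      · rw [zero_mul]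
    simp only [initialCoeff, h1, h2, and_self, if_true, reduceCtorEq, if_false, Vertex.c.injEq, h3,
      Finset.sum_ite_eq', Finset.mem_Icc]
    simp only [twiceDegree]
    ring

/-- The initial seed is graded by every affine grading of the matrix entries. -/
theorem initialSeed_isGraded (hn : 4 ≤ n) (hτ : ∀ t, τ t ≠ 0)
    (hX : IsAffineGraded σ τ a b c (genericMatrix n)) :
    ∃ deg, (initialSeed n).IsGraded σ τ deg := by
  choose deg hdeg hsemi using fun v : MutableVertex n ⊕ FrozenVertex n =>
    initialVar_isSemiInvariant hn hτ hX (toVertex_mem v)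
  refine ⟨deg, ?_, ?_, hsemi, ?_⟩
  · intro k
    change 0 < initialMult n k.1
    unfold initialMult
    split_ifs <;> omega
  · exact fun v w => quiverArrows_no_two_cycles hn (toVertex_mem v) (toVertex_mem w)
  · intro k r hr
    -- The degrees are known only through their doubles, so twice the imbalance is computed and the
    -- factor is cancelled at the end.
    have htwo : 2 * (initialSeed n).imbalance deg k r =
        ∑ w : FrozenVertex n, initialCoeff n k.1 r w.1 * twiceDegree n a b c w.1 +
        r * mutableBalance n (twiceDegree n a b c) k.1 +
        ∑ w : FrozenVertex n, (r * ((quiverArrows n k.1 w.1 : ℤ) - quiverArrows n w.1 k.1)) /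
          (initialMult n k.1 : ℤ) * twiceDegree n a b c w.1 := by
      have hmul : ∀ (x : ℤ) v, 2 * (x * deg v) = x * twiceDegree n a b c (toVertex v) :=
        fun x v => by rw [mul_left_comm, hdeg]
      rw [← sum_mutable_net hn k.2, ExtendedSeed.imbalance, mul_add, mul_add,
        mul_left_comm 2 (r : ℤ)]
      simp only [Finset.mul_sum _ _ (2 : ℤ), hmul]
      rfl
    have hzero : 2 * (initialSeed n).imbalance deg k r = 0 := by
      change r ≤ initialMult n k.1 at hr
      rw [htwo]
      by_cases hk : k.1 = .phi 1 1
      · rw [hk] at hr ⊢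
        rw [mutableBalance_phi_one_one a b c hn, show initialMult n (.phi 1 1) = n - 1 from if_pos rfl]
        exact balance_phi_one_one hn (by simpa [initialMult] using hr)
      · rw [initialMult, if_neg hk] at hr ⊢
        have h0 : ∀ w, initialCoeff n k.1 r w = 0 := fun w => if_neg fun h => hk h.1
        -- At a vertex of multiplicity one only `r = 1` carries a condition, and the floors are
        -- trivial.
        have hr' : r = 0 ∨ r = 1 := by omega
        have hbal := balance_of_ne (a := a) (b := b) (c := c) hn k.2 hk
        rw [← sum_frozen_net] at hbal
        rcases hr' with rfl | rfl
        · simp [h0]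
        · simpa [h0] using hbal
    omega

end InitialSeed

/-! ### Rescaling of the coordinate functions -/

section Scaling

/-- The homomorphism `x_{ij} ↦ t ^ w_{ij} x_{ij}` of the polynomial ring. -/
def scalePoly (w : Fin n × Fin n → ℤ) (t : ℂˣ) :
    MvPolynomial (Fin n × Fin n) ℂ →ₐ[ℂ] MvPolynomial (Fin n × Fin n) ℂ :=
  MvPolynomial.aeval fun ij => MvPolynomial.C ((t : ℂ) ^ w ij) * MvPolynomial.X ij

/-- Invertibility yields the injectivity needed to extend the scaling to the fraction field. -/
theorem scalePoly_inv_scalePoly (w : Fin n × Fin n → ℤ) (t : ℂˣ)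
    (p : MvPolynomial (Fin n × Fin n) ℂ) : scalePoly w t⁻¹ (scalePoly w t p) = p := by
  have h : (scalePoly w t⁻¹).comp (scalePoly w t) = AlgHom.id ℂ _ := by
    ext1 ij
    simp only [scalePoly, AlgHom.comp_apply, MvPolynomial.aeval_X, map_mul, MvPolynomial.algHom_C,
      AlgHom.id_apply, MvPolynomial.algebraMap_eq]
    rw [← mul_assoc, ← MvPolynomial.C_mul, Units.val_inv_eq_inv_val, inv_zpow,
      mul_inv_cancel₀ (zpow_ne_zero _ t.ne_zero), MvPolynomial.C_1, one_mul]
  exact DFunLike.congr_fun h p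

theorem eval_scalePoly (w : Fin n × Fin n → ℤ) (t : ℂˣ) (x : Fin n × Fin n → ℂ)
    (p : MvPolynomial (Fin n × Fin n) ℂ) :
    MvPolynomial.eval x (scalePoly w t p) =
      MvPolynomial.eval (fun ij => (t : ℂ) ^ w ij * x ij) p := by
  have h : (MvPolynomial.eval x).comp (scalePoly w t).toRingHom =
      MvPolynomial.eval fun ij => (t : ℂ) ^ w ij * x ij := by
    ext <;> simp [scalePoly]
  exact DFunLike.congr_fun h p

theorem scalePoly_injective (w : Fin n × Fin n → ℤ) (t : ℂˣ) :
    Function.Injective (scalePoly w t) :=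
  Function.LeftInverse.injective (scalePoly_inv_scalePoly w t)

/-- The endomorphism `x_{ij} ↦ t ^ w_{ij} x_{ij}` of the field of rational functions. -/
def scaleRat (w : Fin n × Fin n → ℤ) (t : ℂˣ) : RatFun n →+* RatFun n :=
  IsFractionRing.lift (g := (algebraMap (MvPolynomial (Fin n × Fin n) ℂ) (RatFun n)).comp
    (scalePoly w t).toRingHom)
    ((IsFractionRing.injective _ _).comp (scalePoly_injective w t))

theorem scaleRat_algebraMap (w : Fin n × Fin n → ℤ) (t : ℂˣ)
    (p : MvPolynomial (Fin n × Fin n) ℂ) :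
    scaleRat w t (algebraMap _ _ p) = algebraMap _ _ (scalePoly w t p) :=
  IsFractionRing.lift_algebraMap _ _

/-- The constant rational function `t`. -/
def constRat (n : ℕ) (t : ℂˣ) : RatFun n :=
  algebraMap (MvPolynomial (Fin n × Fin n) ℂ) (RatFun n) (MvPolynomial.C (t : ℂ))

theorem constRat_ne_zero (t : ℂˣ) : constRat n t ≠ 0 := by
  simp [constRat, t.ne_zero]

theorem constRat_zpow (t : ℂˣ) (d : ℤ) :
    constRat n t ^ d = algebraMap (MvPolynomial (Fin n × Fin n) ℂ) (RatFun n)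
      (MvPolynomial.C ((t : ℂ) ^ d)) :=
  (map_zpow₀ ((algebraMap (MvPolynomial (Fin n × Fin n) ℂ) (RatFun n)).comp
    MvPolynomial.C) (t : ℂ) d).symm

theorem genericMatrix_isAffineGraded (a b c : ℤ) :
    IsAffineGraded
      (scaleRat fun ij : Fin n × Fin n => a + b * ((ij.1 : ℤ) + 1) + c * ((ij.2 : ℤ) + 1))
      (constRat n) a b c (genericMatrix n) := by
  intro i j t
  rw [constRat_zpow]
  simp only [genericMatrix, Matrix.map_apply, Matrix.mvPolynomialX_apply, scaleRat_algebraMap]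
  rw [scalePoly, MvPolynomial.aeval_X, map_mul]

/-- The value of a semi-invariant at a rescaled point. -/
theorem HasValueAt.scale {w : Fin n × Fin n → ℤ} {f : RatFun n} {d : ℤ}
    (hf : IsSemiInvariant (scaleRat w) (constRat n) f d) {t : ℂ} (ht : t ≠ 0)
    {X Y : Matrix (Fin n) (Fin n) ℂ} (hY : ∀ i j, Y i j = t ^ w (i, j) * X i j) {y : ℂ}
    (h : HasValueAt f X y) : HasValueAt f Y (t ^ d * y) := by
  obtain ⟨p, q, hq, hpq, rfl⟩ := h
  set u : ℂˣ := Units.mk0 t ht with hu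
  have heval : ∀ r : MvPolynomial (Fin n × Fin n) ℂ,
      MvPolynomial.eval (fun ij => Y ij.1 ij.2) (scalePoly w u⁻¹ r) =
        MvPolynomial.eval (fun ij => X ij.1 ij.2) r := by
    intro r
    rw [eval_scalePoly]
    congr 2
    funext ij
    rw [hY, hu, Units.val_inv_eq_inv_val, Units.val_mk0, inv_zpow,
      inv_mul_cancel_left₀ (zpow_ne_zero _ ht)]
  -- Semi-invariance under `u⁻¹` says that `f` equals `t ^ d` times its rescaling. Scaling back `p`
  -- and `q` therefore represents `f` by a fraction whose denominator at `Y` is that of the old one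
  -- at `X`, so regularity carries over.
  refine ⟨MvPolynomial.C (t ^ d) * scalePoly w u⁻¹ p, scalePoly w u⁻¹ q, ?_, ?_, ?_⟩
  · rwa [heval]
  · have h1 := hf u⁻¹
    rw [constRat_zpow, Units.val_inv_eq_inv_val, inv_zpow, hu, Units.val_mk0] at h1
    have h2 : scaleRat w u⁻¹ f = algebraMap _ _ (scalePoly w u⁻¹ p) /
        algebraMap _ _ (scalePoly w u⁻¹ q) := by
      rw [hpq, map_div₀, scaleRat_algebraMap, scaleRat_algebraMap]
    rw [map_mul, mul_div_assoc, ← h2, h1, ← mul_assoc, ← map_mul, ← MvPolynomial.C_mul,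
      mul_inv_cancel₀ (zpow_ne_zero _ ht), MvPolynomial.C_1, map_one, one_mul]
  · rw [map_mul, MvPolynomial.eval_C, heval, heval, mul_div_assoc]

end Scaling

/-- Cluster variables are homogeneous with respect to every affine grading of the entries. -/
theorem exists_isSemiInvariant_of_mem_clusterVariables (hn : 4 ≤ n) (a b c : ℤ) {f : RatFun n}
    (hf : f ∈ (initialSeed n).clusterVariables) :
    ∃ d, IsSemiInvariant
      (scaleRat fun ij : Fin n × Fin n => a + b * ((ij.1 : ℤ) + 1) + c * ((ij.2 : ℤ) + 1))
      (constRat n) f d := by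
  obtain ⟨deg, hS⟩ := initialSeed_isGraded hn constRat_ne_zero
    (genericMatrix_isAffineGraded (n := n) a b c)
  exact hS.exists_isSemiInvariant constRat_ne_zero hf

end GCn

end
theorem mainTheorem10 (n : ℕ) (hn : 4 ≤ n) (f : GCn.RatFun n)
    (hf : f ∈ (GCn.initialSeed n).clusterVariables) :
    GCn.IsHomogeneous f ∧ GCn.IsTorusHomogeneous f := by
  constructor
  · obtain ⟨d, hd⟩ := GCn.exists_isSemiInvariant_of_mem_clusterVariables hn 1 0 0 hf
    refine ⟨d, fun a ha X y hy => hy.scale hd ha fun i j => ?_⟩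
    simp
  -- In 1-based numbering `t ^ D_n` multiplies row `i` by `t ^ (n + 1 - i)` and `s ^ D̄_n`
  -- multiplies column `j` by `s ^ j`. The two actions are applied in turn, through the intermediate
  -- point `t ^ D_n X`.
  · obtain ⟨ξ, hξ⟩ := GCn.exists_isSemiInvariant_of_mem_clusterVariables hn (n + 1) (-1) 0 hf
    obtain ⟨ξ', hξ'⟩ := GCn.exists_isSemiInvariant_of_mem_clusterVariables hn 0 0 1 hf
    refine ⟨ξ, ξ', fun t s ht hs X y hy => ?_⟩
    have h := (hy.scale hξ ht (Y := GCn.powDiag t (fun i : Fin n => n - (i : ℕ)) * X)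
      fun i j => ?_).scale hξ' hs
      (Y := GCn.powDiag t (fun i : Fin n => n - (i : ℕ)) * X *
        GCn.powDiag s (fun i : Fin n => (i : ℕ) + 1)) fun i j => ?_
    · rwa [← mul_assoc, mul_comm (s ^ ξ')] at h
    · rw [GCn.powDiag, Matrix.diagonal_mul, ← zpow_natCast, Nat.cast_sub i.2.le]
      congr 2
      ring
    · rw [GCn.powDiag, GCn.powDiag, Matrix.mul_diagonal, mul_comm, ← zpow_natCast]
      congr 2
      push_cast
      ring
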